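/- Let $d\ge 2$ and $n>d$, let $x_1,\dots,x_n\in\mathbb R^d$ be distinct, and for each $i$ let $x_{i,1},\dots,x_{i,d}$ be $d$ nearest neighbours of $x_i$ among the other points. Let $0<\delta\le\varepsilon$, let $S_i\subset\mathbb R^d$ be a sphere of dimension $d-1$ and radius $R_i>0$ through $x_i$ and through the points $(1-\varepsilon)x_i+\varepsilon x_{i,j}$ ($1\le j\le d$), and assume $\delta<2R_i$. The \emph{hyper-cap} at $x_i$ is $S_i'=\{p\in S_i:\|p-x_i\|\le\delta\}$. Let $\nu_i$ be the outward unit normal of $S_i$ at $x_i$; the rim $\{p\in S_i:\|p-x_i\|=\delta\}$ is $\{q_i+\rho_i u:\ \|u\|=1,\ u\perp\nu_i\}$ for its centre $q_i$ and radius $\rho_i>0$. For a unit vector $w\perp\nu_i$ and $0\le c<1$ let $H_i(w,c)=\{u:\|u\|=1,\ u\perp \nu_i,\ \langle w,u\rangle\ge c\}$; for $c=0$ this is half of the rim. Arrange the caps in a chain $S'_{i_1},\dots,S'_{i_n}$, where $(i_1,\dots,i_n)$ is a permutation of $(1,\dots,n)$, and choose unit vectors $w_k\perp\nu_{i_k}$.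 For $1\le k<n$ choose a rotation $T_k\in SO(d)$ with $T_kw_k=w_{k+1}$ and $T_k\nu_{i_k}=\pm\nu_{i_{k+1}}$. The \emph{partial hyper-cylinder} $c_k$ between the $k$-th and the $(k+1)$-st cap consists of the open straight segments from $q_{i_k}+\rho_{i_k}u$ to $q_{i_{k+1}}+\rho_{i_{k+1}}\big(T_ku-2\langle w_k,u\rangle w_{k+1}\big)$, $u\in H_{i_k}(w_k,0)$; it joins the half of the first rim on the side of $w_k$ to the half of the second rim on the side of $-w_{k+1}$. Assume that the caps and the partial hyper-cylinders are pairwise disjoint and that no partial hyper-cylinder (with its end faces) intersects itself. (1) \emph{First approach.} Let $s$ be a hyper-strip that closes the chain: for some $0\le c<1$ and some $T\in SO(d)$ with $Tw_n=w_1$, $T\nu_{i_n}=\pm\nu_{i_1}$, $s$ is the image of $H_{i_n}(w_n,c)\times(0,1)$ under a continuous injective map $\sigma:H_{i_n}(w_n,c)\times[0,1]\to\mathbb R^d$ with $\sigma(u,0)=q_{i_n}+\rho_{i_n}u$ and $\sigma(u,1)=q_{i_1}+\rho_{i_1}(Tu-2\langle w_n,u\rangle w_1)$, and $s$ is disjoint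 from all caps and partial hyper-cylinders. Suppose that the strip is untwisted: there are sides $\mu_k\in\{\nu_{i_k},-\nu_{i_k}\}$ of the caps with $T_k\mu_k=\mu_{k+1}$ for $1\le k<n$ and $T\mu_n=\mu_1$. Then the hypersurface $$\mathcal W=\bigsqcup_{i=1}^n S_i'\ \sqcup\ \bigsqcup_{k=1}^{n-1}c_k\ \sqcup\ s ,$$ with the topology induced from $\mathbb R^d$, is an orientable $(d-1)$-dimensional manifold with (possibly empty) boundary. (2) \emph{Second approach.} Let $e$ be a unit vector, $0\le c_0,c_1<1$, and let $s_0,s_1$ be half-infinite hyper-strips from the two ends of the chain to infinity in the opposite directions $e$ and $-e$: $s_0$ is the image of $H_{i_1}(-w_1,c_0)\times(0,\infty)$ under a continuous injective map $\sigma_0$ on $H_{i_1}(-w_1,c_0)\times[0,\infty)$ with $\sigma_0(u,0)=q_{i_1}+\rho_{i_1}u$ and, uniformly in $u$, $\|\sigma_0(u,t)\|\to\infty$ and $\sigma_0(u,t)/\|\sigma_0(u,t)\|\to e$ as $t\to\infty$; and $s_1$ is defined in the same way from $H_{i_n}(w_n,c_1)$ at the last cap, with $-e$ in place of $e$. Suppose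 that $s_0$ and $s_1$ are disjoint from each other and from all caps and partial hyper-cylinders. Then $$\mathcal W=\bigsqcup_{i=1}^n S_i'\ \sqcup\ \bigsqcup_{k=1}^{n-1}c_k\ \sqcup\ s_0\ \sqcup\ s_1 ,$$ with the topology induced from $\mathbb R^d$, is an orientable $(d-1)$-dimensional manifold with (possibly empty) boundary. Here a space is called an orientable $m$-manifold with boundary if it has a smooth atlas of charts into the closed half-space of $\mathbb R^m$ and a choice of an orientation (sign) of each chart with which the signs of the Jacobian determinants of all coordinate changes are compatible. -/

import Mathlib

open scoped Manifold ContDiff RealInnerProductSpace Topology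

noncomputable section

/-- A topological space `M` is an orientable `m`-manifold with (possibly empty) boundary: it has
a smooth atlas of charts into the `m`-dimensional half-space and a choice of orientation (a sign) of
every chart such that every coordinate change is compatible with the chosen orientations, that is,
its Jacobian determinant has the sign `sgn e * sgn e'`. (Signs on charts, rather than positive
Jacobians, give the usual notion in dimension one too.) -/
def IsOrientable (m : ℕ) [NeZero m] (M : Type*) [TopologicalSpace M] : Prop :=
  ∃ _ : ChartedSpace (EuclideanHalfSpace m) M,
    IsManifold (𝓡∂ m) ∞ M ∧
    ∃ sgn : OpenPartialHomeomorph M (EuclideanHalfSpace m) → ℤˣ,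
      ∀ e ∈ atlas (EuclideanHalfSpace m) M, ∀ e' ∈ atlas (EuclideanHalfSpace m) M,
        ∀ p ∈ e.source ∩ e'.source,
          0 < (((sgn e * sgn e' : ℤˣ) : ℤ) : ℝ) *
            (fderivWithin ℝ (e'.extend (𝓡∂ m) ∘ (e.extend (𝓡∂ m)).symm)
              (Set.range (𝓡∂ m)) (e.extend (𝓡∂ m) p)).det

/-- The ambient space `ℝ ^ d` with `d = m + 1`; hypersurfaces in it have dimension `m`. -/
abbrev Ambient (m : ℕ) : Type := EuclideanSpace ℝ (Fin (m + 1))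

/-- A dataset of `n` points in `ℝ ^ d`, `d = m + 1`, together with `d` nearest neighbours of every
point, osculating hyperspheres `S i` (through `x i` and its neighbours after these have been moved
towards `x i`, to the fraction `ε` of their distance), and the radius `δ` of the hyper-caps. -/
structure HyperCaps (m n : ℕ) where
  x : Fin n → Ambient m
  x_injective : Function.Injective x
  nbr : Fin n → Fin (m + 1) → Fin n
  nbr_injective : ∀ i, Function.Injective (nbr i)
  nbr_ne : ∀ i j, nbr i j ≠ i
  nbr_nearest : ∀ i j k, k ≠ i → k ∉ Set.range (nbr i) →
    dist (x i) (x (nbr i j)) ≤ dist (x i) (x k)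
  ε : ℝ
  ε_pos : 0 < ε
  S : Fin n → EuclideanGeometry.Sphere (Ambient m)
  radius_pos : ∀ i, 0 < (S i).radius
  x_mem : ∀ i, x i ∈ S i
  nbr_mem : ∀ i j, (1 - ε) • x i + ε • x (nbr i j) ∈ S i
  δ : ℝ
  δ_pos : 0 < δ
  δ_le : δ ≤ ε
  /-- The cap is a proper part of the hypersphere. -/
  δ_lt : ∀ i, δ < 2 * (S i).radius

namespace HyperCaps

variable {m n : ℕ} (K : HyperCaps m n)

/-- The hyper-cap around `x i`. -/
def cap (i : Fin n) : Set (Ambient m) := {p | p ∈ K.S i ∧ ‖p - K.x i‖ ≤ K.δ}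

/-- The outward unit normal of the hypersphere `S i` at `x i`. -/
def normal (i : Fin n) : Ambient m := (K.S i).radius⁻¹ • (K.x i - (K.S i).center)

/-- The rim `{p ∈ S i | ‖p - x i‖ = δ}` of the hyper-cap is an `(m - 1)`-sphere in a hyperplane
orthogonal to `normal i`; this is its centre. -/
def rimCenter (i : Fin n) : Ambient m := K.x i - (K.δ ^ 2 / (2 * (K.S i).radius)) • K.normal i

/-- The radius of the rim of the hyper-cap. -/
def rimRadius (i : Fin n) : ℝ := K.δ * √(1 - K.δ ^ 2 / (4 * (K.S i).radius ^ 2))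

/-- The point of the rim in the direction of the unit vector `u` orthogonal to `normal i`. -/
def rimPt (i : Fin n) (u : Ambient m) : Ambient m := K.rimCenter i + K.rimRadius i • u

/-- The directions of a part of the rim: all rim directions `u` with `⟪w, u⟫ ≥ c`. For a unit
vector `w` orthogonal to `normal i` and `c = 0` this is the (closed) half of the rim on the side of
`w`; for `0 < c < 1` it is a smaller round part of that half. -/
def rimPart (i : Fin n) (w : Ambient m) (c : ℝ) : Set (Ambient m) :=
  {u | ‖u‖ = 1 ∧ ⟪K.normal i, u⟫ = 0 ∧ c ≤ ⟪w, u⟫}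

end HyperCaps

/-- `T` is a rotation that carries the direction of travel `w` to `w'` and the normal line of `ν` to
that of `ν'` (hence also the transverse directions, orthogonal to `ν` and `w`, to those orthogonal to
`ν'` and `w'`). -/
structure CarriesFrame {m : ℕ} (T : Ambient m ≃ₗᵢ[ℝ] Ambient m) (ν w ν' w' : Ambient m) : Prop where
  det_eq : LinearMap.det (T.toLinearEquiv : Ambient m →ₗ[ℝ] Ambient m) = 1
  map_dir : T w = w'
  map_normal : T ν = ν' ∨ T ν = -ν'

/-- How a connecting piece that leaves a cap in direction `w`, arrives at the next cap in direction
`w'`, and carries its transverse directions by `T`, identifies the half of the first rim on the side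
of `w` with the half of the second rim on the side of `-w'`: `y • w + z ↦ -y • w' + T z`. -/
def glue {m : ℕ} (T : Ambient m ≃ₗᵢ[ℝ] Ambient m) (w w' u : Ambient m) : Ambient m :=
  T u - (2 * ⟪w, u⟫) • w'

/-- The partial hyper-cylinders. The caps are arranged in a chain (`ord k` is the index of the
`k`-th cap of the chain), and consecutive caps are joined by half of a straight hyper-cylinder. At
every cap of the chain, the incoming connection uses the half of the rim on the side of `-dir k` and
the outgoing one uses the opposite half. -/
structure CapChain {m N : ℕ} (K : HyperCaps m (N + 1)) where
  ord : Equiv.Perm (Fin (N + 1))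
  dir : Fin (N + 1) → Ambient m
  norm_dir : ∀ k, ‖dir k‖ = 1
  dir_tangent : ∀ k, ⟪K.normal (ord k), dir k⟫ = 0
  rot : Fin N → (Ambient m ≃ₗᵢ[ℝ] Ambient m)
  rot_carries : ∀ k, CarriesFrame (rot k) (K.normal (ord k.castSucc)) (dir k.castSucc)
    (K.normal (ord k.succ)) (dir k.succ)

namespace CapChain

variable {m N : ℕ} {K : HyperCaps m (N + 1)} (C : CapChain K)

/-- The `k`-th partial hyper-cylinder is ruled by the straight segments between identified points of
half the rim of the `k`-th cap and half the rim of the next one. -/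
def cylPt (k : Fin N) (u : Ambient m) (t : ℝ) : Ambient m :=
  (1 - t) • K.rimPt (C.ord k.castSucc) u +
    t • K.rimPt (C.ord k.succ) (glue (C.rot k) (C.dir k.castSucc) (C.dir k.succ) u)

/-- The directions of the half of the `k`-th rim from which the `k`-th hyper-cylinder leaves. -/
def half (k : Fin N) : Set (Ambient m) := K.rimPart (C.ord k.castSucc) (C.dir k.castSucc) 0

/-- The `k`-th partial hyper-cylinder, without its two end faces (these lie in the caps). -/
def cyl (k : Fin N) : Set (Ambient m) :=
  (fun q : Ambient m × ℝ => C.cylPt k q.1 q.2) '' (C.half k ×ˢ Set.Ioo 0 1)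

/-- The caps and the partial hyper-cylinders do not intersect one another or themselves. -/
structure Embedded : Prop where
  cyl_injOn : ∀ k, Set.InjOn (fun q : Ambient m × ℝ => C.cylPt k q.1 q.2)
    (C.half k ×ˢ Set.Icc 0 1)
  cap_disjoint : ∀ i j, i ≠ j → Disjoint (K.cap i) (K.cap j)
  cyl_disjoint : ∀ k l, k ≠ l → Disjoint (C.cyl k) (C.cyl l)
  cap_cyl_disjoint : ∀ i k, Disjoint (K.cap i) (C.cyl k)

/-- The (disjoint) union of all caps and all partial hyper-cylinders. -/
def body : Set (Ambient m) := (⋃ i, K.cap i) ∪ ⋃ k, C.cyl k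

end CapChain

/-- First approach: a hyper-strip which connects the last cap of the chain to the first one,
leaving and arriving at round parts of the free halves of the two rims, and which does not intersect
itself, the caps, or the partial hyper-cylinders. -/
structure ClosingStrip {m N : ℕ} {K : HyperCaps m (N + 1)} (C : CapChain K) where
  c : ℝ
  c_nonneg : 0 ≤ c
  c_lt_one : c < 1
  rot : Ambient m ≃ₗᵢ[ℝ] Ambient m
  rot_carries : CarriesFrame rot (K.normal (C.ord (Fin.last N))) (C.dir (Fin.last N))
    (K.normal (C.ord 0)) (C.dir 0)
  map : Ambient m × ℝ → Ambient m
  continuousOn :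
    ContinuousOn map (K.rimPart (C.ord (Fin.last N)) (C.dir (Fin.last N)) c ×ˢ Set.Icc 0 1)
  injOn : Set.InjOn map (K.rimPart (C.ord (Fin.last N)) (C.dir (Fin.last N)) c ×ˢ Set.Icc 0 1)
  map_zero : ∀ u ∈ K.rimPart (C.ord (Fin.last N)) (C.dir (Fin.last N)) c,
    map (u, 0) = K.rimPt (C.ord (Fin.last N)) u
  map_one : ∀ u ∈ K.rimPart (C.ord (Fin.last N)) (C.dir (Fin.last N)) c,
    map (u, 1) = K.rimPt (C.ord 0) (glue rot (C.dir (Fin.last N)) (C.dir 0) u)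
  disjoint_body : Disjoint C.body
    (map '' (K.rimPart (C.ord (Fin.last N)) (C.dir (Fin.last N)) c ×ˢ Set.Ioo 0 1))

namespace ClosingStrip

variable {m N : ℕ} {K : HyperCaps m (N + 1)} {C : CapChain K} (s : ClosingStrip C)

/-- The hyper-strip, without its two end faces (these lie in the caps). -/
def strip : Set (Ambient m) :=
  s.map '' (K.rimPart (C.ord (Fin.last N)) (C.dir (Fin.last N)) s.c ×ˢ Set.Ioo 0 1)

/-- The strip is not twisted: one can choose one of the two sides (unit normals) of every cap so that
every hyper-cylinder of the chain carries the chosen side of its first cap to the chosen side of its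
second one, and so does the closing strip. (Along the hyper-cylinders alone, this can always be
achieved, so this is a condition on the strip.) -/
def Untwisted : Prop :=
  ∃ side : Fin (N + 1) → Ambient m,
    (∀ k, side k = K.normal (C.ord k) ∨ side k = -K.normal (C.ord k)) ∧
    (∀ k : Fin N, C.rot k (side k.castSucc) = side k.succ) ∧
    s.rot (side (Fin.last N)) = side 0

/-- The hypersurface of the first approach. -/
def hypersurface : Set (Ambient m) := C.body ∪ s.strip

end ClosingStrip

/-- A half-infinite hyper-strip which starts at the part of the rim of the cap `i` given by `w` and
`c`, and goes to the point at infinity in the direction of the unit vector `e`. -/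
structure IsStripToInfinity {m n : ℕ} (K : HyperCaps m n) (i : Fin n) (w : Ambient m) (c : ℝ)
    (e : Ambient m) (map : Ambient m × ℝ → Ambient m) : Prop where
  continuousOn : ContinuousOn map (K.rimPart i w c ×ˢ Set.Ici 0)
  injOn : Set.InjOn map (K.rimPart i w c ×ˢ Set.Ici 0)
  map_zero : ∀ u ∈ K.rimPart i w c, map (u, 0) = K.rimPt i u
  tendsto_norm : Filter.Tendsto (fun q => ‖map q‖)
    (Filter.principal (K.rimPart i w c) ×ˢ Filter.atTop) Filter.atTop
  tendsto_dir : Filter.Tendsto (fun q => ‖map q‖⁻¹ • map q)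
    (Filter.principal (K.rimPart i w c) ×ˢ Filter.atTop) (𝓝 e)

/-- Second approach: two disjoint hyper-strips which connect the first and the last cap of the chain
to two points at infinity in opposite directions, and which do not intersect the caps or the partial
hyper-cylinders. -/
structure InfiniteStrips {m N : ℕ} {K : HyperCaps m (N + 1)} (C : CapChain K) where
  e : Ambient m
  norm_e : ‖e‖ = 1
  c₀ : ℝ
  c₀_nonneg : 0 ≤ c₀
  c₀_lt_one : c₀ < 1
  c₁ : ℝ
  c₁_nonneg : 0 ≤ c₁
  c₁_lt_one : c₁ < 1
  map₀ : Ambient m × ℝ → Ambient m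
  map₁ : Ambient m × ℝ → Ambient m
  isStrip₀ : IsStripToInfinity K (C.ord 0) (-C.dir 0) c₀ e map₀
  isStrip₁ : IsStripToInfinity K (C.ord (Fin.last N)) (C.dir (Fin.last N)) c₁ (-e) map₁
  disjoint_body₀ : Disjoint C.body (map₀ '' (K.rimPart (C.ord 0) (-C.dir 0) c₀ ×ˢ Set.Ioi 0))
  disjoint_body₁ : Disjoint C.body
    (map₁ '' (K.rimPart (C.ord (Fin.last N)) (C.dir (Fin.last N)) c₁ ×ˢ Set.Ioi 0))
  disjoint_strips : Disjoint (map₀ '' (K.rimPart (C.ord 0) (-C.dir 0) c₀ ×ˢ Set.Ioi 0))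
    (map₁ '' (K.rimPart (C.ord (Fin.last N)) (C.dir (Fin.last N)) c₁ ×ˢ Set.Ioi 0))

namespace InfiniteStrips

variable {m N : ℕ} {K : HyperCaps m (N + 1)} {C : CapChain K} (s : InfiniteStrips C)

/-- The strip at the first cap, without its end face. -/
def strip₀ : Set (Ambient m) := s.map₀ '' (K.rimPart (C.ord 0) (-C.dir 0) s.c₀ ×ˢ Set.Ioi 0)

/-- The strip at the last cap, without its end face. -/
def strip₁ : Set (Ambient m) :=
  s.map₁ '' (K.rimPart (C.ord (Fin.last N)) (C.dir (Fin.last N)) s.c₁ ×ˢ Set.Ioi 0)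

/-- The hypersurface of the second approach. -/
def hypersurface : Set (Ambient m) := C.body ∪ s.strip₀ ∪ s.strip₁

end InfiniteStrips

end

/-! Both hypersurfaces are swept out by columns over the closed hemisphere `Hemi m`, which is a
closed disc of dimension m - 1. A cap is a closed m-disc, filled by one column for each u, running
from the incoming part of its rim to the outgoing part; the unattached part of the rim is covered by
columns over the edge of the hemisphere. A cylinder or strip is a product of a rim part with an
interval. In tangent frames carried along by the rotations, every gluing inside the chain is the
reflection of the axis, so the column of u leaving one cap continues as the column of u in the next
(`HyperCaps.exists_cap_columns`, `CapChain.exists_columns`).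

In the second approach the columns continue to infinity at both ends, and properness makes the
hypersurface homeomorphic to `Hemi m × ℝ`. In the first approach the top of the column of u is glued
to the bottom of the column of A u, for an isometry A fixing the axis, so `Hemi m × ℝ` covers the
hypersurface with the identifications of (u, t) with (A⁻ᵏ u, t + k) (`exists_periodic_columns`).

The map (u, t) ↦ eᵗ u carries `Hemi m × ℝ` onto the punctured half-space and turns these
identifications into the linear maps eᵏ A⁻ᵏ. Local inverses of the covering therefore give charts
with locally linear coordinate changes, which preserve orientation if det A > 0
(`isOrientable_of_polar_cover`).

Finally, the composition Q of all rotations around the chain has determinant 1 and acts as A on the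
first tangent hyperplane. Untwistedness says that Q fixes the normal, whence det A = det Q = 1
(`IsTangentFrame.det_eq`). -/

/-! ### Orientability from locally linear coordinate changes -/

section Charts

variable {m : ℕ} [NeZero m] {M : Type*} [TopologicalSpace M]

/-- Passes from germs on `M` to germs within the range of the model, the form in which both
smoothness and the Jacobian are tested, boundary points included. -/
theorem coordChange_eventuallyEq {e e' : OpenPartialHomeomorph M (EuclideanHalfSpace m)} {p : M}
    (hp : p ∈ e.source) {B : EuclideanSpace ℝ (Fin m) →L[ℝ] EuclideanSpace ℝ (Fin m)}
    (hB : ∀ᶠ q in 𝓝 p, (e' q).1 = B (e q).1) :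
    (e'.extend (𝓡∂ m) ∘ (e.extend (𝓡∂ m)).symm) =ᶠ[𝓝[Set.range (𝓡∂ m)] (e.extend (𝓡∂ m) p)] B := by
  have h0 : (𝓡∂ m).symm (e.extend (𝓡∂ m) p) = e p := (𝓡∂ m).left_inv _
  have h1 : Filter.Tendsto (𝓡∂ m).symm (𝓝 (e.extend (𝓡∂ m) p)) (𝓝 (e p)) := by
    have := (𝓡∂ m).continuous_symm.tendsto (e.extend (𝓡∂ m) p)
    rwa [h0] at this
  have h2 : Filter.Tendsto e.symm (𝓝 (e p)) (𝓝 p) := by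
    simpa only [e.left_inv hp] using (e.continuousAt_symm (e.map_source hp)).tendsto
  filter_upwards [nhdsWithin_le_nhds ((h2.comp h1).eventually hB),
    nhdsWithin_le_nhds (h1.eventually (e.open_target.mem_nhds (e.map_source hp))),
    self_mem_nhdsWithin] with y hy hy' hyr
  have h3 : (e ((e.symm ∘ (𝓡∂ m).symm) y)).1 = y := by
    have : e (e.symm ((𝓡∂ m).symm y)) = (𝓡∂ m).symm y := e.right_inv hy'
    simp only [Function.comp_apply, this]
    exact (𝓡∂ m).right_inv hyr
  rw [h3] at hy
  exact hy

/-- If all coordinate changes are locally linear with positive determinant, then the space is an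
orientable manifold. -/
theorem isOrientable_of_charts (𝒜 : Set (OpenPartialHomeomorph M (EuclideanHalfSpace m)))
    (hcover : ∀ p, ∃ e ∈ 𝒜, p ∈ e.source)
    (h : ∀ e ∈ 𝒜, ∀ e' ∈ 𝒜, ∀ p ∈ e.source ∩ e'.source,
      ∃ B : EuclideanSpace ℝ (Fin m) →L[ℝ] EuclideanSpace ℝ (Fin m), 0 < B.det ∧
        ∀ᶠ q in 𝓝 p, (e' q).1 = B (e q).1) : IsOrientable m M := by
  choose ch hch hmem using hcover
  let inst : ChartedSpace (EuclideanHalfSpace m) M :=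
    { atlas := 𝒜
      chartAt := ch
      mem_chart_source := hmem
      chart_mem_atlas := hch }
  refine ⟨inst, isManifold_of_contDiffOn _ _ _ ?_, fun _ => 1, ?_⟩
  · intro e e' he he' x hx
    obtain ⟨⟨hx1, hx2⟩, y, rfl⟩ := hx
    have hy : (𝓡∂ m).symm ((𝓡∂ m) y) = y := (𝓡∂ m).left_inv y
    rw [hy] at hx1 hx2
    obtain ⟨B, -, hB⟩ := h e he e' he' (e.symm y) ⟨e.map_target hx1, hx2⟩
    have key := coordChange_eventuallyEq (e.map_target hx1) hB
    have h4 : e.extend (𝓡∂ m) (e.symm y) = (𝓡∂ m) y := by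
      simp only [OpenPartialHomeomorph.extend_coe, Function.comp_apply]
      rw [e.right_inv hx1]
    rw [h4] at key
    have : ContDiffWithinAt ℝ ∞ B (Set.range (𝓡∂ m)) ((𝓡∂ m) y) := B.contDiff.contDiffWithinAt
    exact (this.congr_of_eventuallyEq key
      (key.self_of_nhdsWithin ⟨y, rfl⟩)).mono Set.inter_subset_right
  · intro e he e' he' p hp
    obtain ⟨B, hdet, hB⟩ := h e he e' he' p hp
    have key := coordChange_eventuallyEq hp.1 hB
    have hr : e.extend (𝓡∂ m) p ∈ Set.range (𝓡∂ m) := ⟨e p, rfl⟩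
    rw [key.fderivWithin_eq (key.self_of_nhdsWithin hr),
      B.fderivWithin ((𝓡∂ m).uniqueDiffOn _ hr)]
    simpa using hdet

end Charts

/-! ### Polar coordinates on the half-space and quotients of `Hemi m × ℝ` -/

section Polar

variable {m : ℕ} [NeZero m] {M : Type*} [TopologicalSpace M]

/-- The closed unit hemisphere. -/
def Hemi (m : ℕ) [NeZero m] : Set (EuclideanSpace ℝ (Fin m)) := {u | ‖u‖ = 1 ∧ 0 ≤ u 0}

/-- Polar coordinates on the punctured half-space. -/
noncomputable def polar (m : ℕ) [NeZero m] :
    Hemi m × ℝ ≃ₜ {x : EuclideanHalfSpace m // x.1 ≠ 0} where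
  toFun z := ⟨⟨Real.exp z.2 • z.1.1, by
      have := z.1.2.2
      simp only [PiLp.smul_apply, smul_eq_mul]
      positivity⟩, by
    have : z.1.1 ≠ 0 := norm_ne_zero_iff.1 (by rw [z.1.2.1]; exact one_ne_zero)
    exact smul_ne_zero (Real.exp_pos _).ne' this⟩
  invFun x := (⟨‖x.1.1‖⁻¹ • x.1.1, by
      refine ⟨norm_smul_inv_norm x.2, ?_⟩
      have := x.1.2
      simp only [PiLp.smul_apply, smul_eq_mul]
      positivity⟩, Real.log ‖x.1.1‖)
  left_inv := by
    rintro ⟨⟨u, hu, hu'⟩, t⟩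
    have h : ‖Real.exp t • u‖ = Real.exp t := by
      rw [norm_smul, hu, mul_one, Real.norm_eq_abs, abs_of_pos (Real.exp_pos t)]
    ext1
    · apply Subtype.ext
      simp only [h, smul_smul]
      rw [inv_mul_cancel₀ (Real.exp_pos t).ne', one_smul]
    · simp only [h, Real.log_exp]
  right_inv := by
    rintro ⟨⟨x, hx⟩, hx'⟩
    apply Subtype.ext
    apply Subtype.ext
    have : 0 < ‖x‖ := norm_pos_iff.2 hx'
    simp only [Real.exp_log this, smul_smul]
    rw [mul_inv_cancel₀ this.ne', one_smul]
  continuous_toFun := by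
    refine Continuous.subtype_mk (Continuous.subtype_mk ?_ _) _
    fun_prop
  continuous_invFun := by
    have h1 : Continuous fun x : {x : EuclideanHalfSpace m // x.1 ≠ 0} => x.1.1 :=
      continuous_subtype_val.comp continuous_subtype_val
    have h2 : ∀ x : {x : EuclideanHalfSpace m // x.1 ≠ 0}, ‖x.1.1‖ ≠ 0 :=
      fun x => norm_ne_zero_iff.2 x.2
    refine Continuous.prodMk (Continuous.subtype_mk ?_ _) (h1.norm.log h2)
    exact (h1.norm.inv₀ h2).smul h1

theorem isOpenEmbedding_polar :
    Topology.IsOpenEmbedding fun z : Hemi m × ℝ => (polar m z).1 := by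
  have h : IsOpen {x : EuclideanHalfSpace m | x.1 ≠ 0} :=
    isOpen_ne.preimage (continuous_subtype_val : Continuous fun x : EuclideanHalfSpace m => x.1)
  exact h.isOpenEmbedding_subtypeVal.comp (polar m).isOpenEmbedding

theorem det_zpow_pos {V : Type*} [NormedAddCommGroup V] [NormedSpace ℝ V] (A : V ≃ₗᵢ[ℝ] V)
    (hA : 0 < LinearMap.det (A.toLinearEquiv : V →ₗ[ℝ] V)) (k : ℤ) :
    0 < LinearMap.det ((A ^ k).toLinearEquiv : V →ₗ[ℝ] V) := by
  have key : ∀ B : V ≃ₗᵢ[ℝ] V, LinearMap.det ((B * A).toLinearEquiv : V →ₗ[ℝ] V) =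
      LinearMap.det (B.toLinearEquiv : V →ₗ[ℝ] V) *
        LinearMap.det (A.toLinearEquiv : V →ₗ[ℝ] V) := by
    intro B
    rw [← LinearMap.det_comp]
    rfl
  induction k using Int.induction_on with
  | zero =>
    have : ((A ^ (0 : ℤ)).toLinearEquiv : V →ₗ[ℝ] V) = LinearMap.id := by
      rw [zpow_zero]; rfl
    rw [this, LinearMap.det_id]
    exact one_pos
  | succ i ih =>
    rw [zpow_add_one, key]
    exact mul_pos ih hA
  | pred i ih =>
    have := key (A ^ (-(i : ℤ) - 1))
    rw [← zpow_add_one, sub_add_cancel] at this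
    rw [this] at ih
    exact pos_of_mul_pos_left ih hA.le

/-- The charts are local inverses of `Φ` followed by `polar`. The identification (u, t) ↦ (Aᵏ u, t +
kn) becomes x ↦ exp(kn) Aᵏ x in polar coordinates, a linear map of positive determinant. With `A =
1` this also covers an injective `Φ`. -/
theorem isOrientable_of_polar_cover {Φ : Hemi m × ℝ → M} (hΦ : IsLocalHomeomorph Φ)
    (hsurj : Function.Surjective Φ)
    (A : EuclideanSpace ℝ (Fin m) ≃ₗᵢ[ℝ] EuclideanSpace ℝ (Fin m))
    (hA : 0 < LinearMap.det
      (A.toLinearEquiv : EuclideanSpace ℝ (Fin m) →ₗ[ℝ] EuclideanSpace ℝ (Fin m)))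
    {n : ℝ} (hn : 0 < n)
    (hfib : ∀ z z', Φ z = Φ z' → ∃ k : ℤ, z'.2 = z.2 + k * n ∧ z'.1.1 = (A ^ k) z.1.1) :
    IsOrientable m M := by
  -- Turning the open embedding into an `OpenPartialHomeomorph` needs a nonempty source.
  rcases isEmpty_or_nonempty (Hemi m × ℝ) with hE | hE
  · exact isOrientable_of_charts ∅ (fun p => hE.elim (hsurj p).choose) (by simp)
  let χ := isOpenEmbedding_polar.toOpenPartialHomeomorph (fun z : Hemi m × ℝ => (polar m z).1)
  refine isOrientable_of_charts
    {e | ∃ f : OpenPartialHomeomorph (Hemi m × ℝ) M, Φ = f ∧ e = f.symm ≫ₕ χ} ?_ ?_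
  · intro p
    obtain ⟨z, rfl⟩ := hsurj p
    obtain ⟨f, hz, hf⟩ := hΦ z
    refine ⟨f.symm ≫ₕ χ, ⟨f, hf, rfl⟩, ?_⟩
    have : Φ z ∈ f.target := by rw [hf]; exact f.map_source hz
    simp [χ, this]
  · rintro _ ⟨f, hf, rfl⟩ _ ⟨f', hf', rfl⟩ p ⟨⟨hp, -⟩, ⟨hp', -⟩⟩
    have hfp : ∀ q ∈ f.target, Φ (f.symm q) = q := fun q hq => by rw [hf]; exact f.right_inv hq
    have hfp' : ∀ q ∈ f'.target, Φ (f'.symm q) = q := fun q hq => by rw [hf']; exact f'.right_inv hq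
    have hp : p ∈ f.target := hp
    have hp' : p ∈ f'.target := hp'
    obtain ⟨k, hk, -⟩ := hfib (f.symm p) (f'.symm p) (by rw [hfp p hp, hfp' p hp'])
    let B : EuclideanSpace ℝ (Fin m) →L[ℝ] EuclideanSpace ℝ (Fin m) :=
      Real.exp (k * n) • ((A ^ k).toContinuousLinearEquiv :
        EuclideanSpace ℝ (Fin m) →L[ℝ] EuclideanSpace ℝ (Fin m))
    have hB : B.det = Real.exp (k * n) ^ Module.finrank ℝ (EuclideanSpace ℝ (Fin m)) *
        LinearMap.det ((A ^ k).toLinearEquiv :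
          EuclideanSpace ℝ (Fin m) →ₗ[ℝ] EuclideanSpace ℝ (Fin m)) := by
      rw [← LinearMap.det_smul]
      rfl
    refine ⟨B, ?_, ?_⟩
    · rw [hB]
      exact mul_pos (pow_pos (Real.exp_pos _) _) (det_zpow_pos A hA k)
    -- The integer relating two local lifts is locally constant: their heights differ continuously
    -- and by integer multiples of `n`.
    have hc : ContinuousAt (fun q => (f'.symm q).2 - (f.symm q).2) p :=
      (continuous_snd.continuousAt.comp (f'.continuousAt_symm hp')).sub
        (continuous_snd.continuousAt.comp (f.continuousAt_symm hp))
    filter_upwards [f.open_target.mem_nhds hp, f'.open_target.mem_nhds hp',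
      Metric.continuousAt_iff'.1 hc n hn] with q hq hq' hd
    obtain ⟨l, hl, hl'⟩ := hfib (f.symm q) (f'.symm q) (by rw [hfp q hq, hfp' q hq'])
    have hlk : l = k := by
      rw [Real.dist_eq, hl, hk, add_sub_cancel_left, add_sub_cancel_left, ← sub_mul, abs_mul,
        abs_of_pos hn] at hd
      have h1 : |(l : ℝ) - k| < 1 := by
        by_contra hcon
        nlinarith
      have h2 : |l - k| < 1 := by exact_mod_cast h1
      have := Int.abs_lt_one_iff.1 h2
      omega
    subst hlk
    change Real.exp (f'.symm q).2 • (f'.symm q).1.1 =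
      Real.exp (l * n) • (A ^ l) (Real.exp (f.symm q).2 • (f.symm q).1.1)
    rw [hl, hl', map_smul, smul_smul, ← Real.exp_add, add_comm]

end Polar

/-! ### Concatenation of columns and periodic columns -/

section Columns

variable {K X : Type*} [TopologicalSpace K] [TopologicalSpace X]

/-- Countably many pieces `K × [0, 1]`, each starting where the previous one ends, make up a
continuous map on `K × ℝ`. -/
theorem continuous_glue_int {β : ℤ → K × ℝ → X} (hβ : ∀ j, Continuous (β j))
    (hm : ∀ j u, β j (u, 1) = β (j + 1) (u, 0)) :
    Continuous fun z : K × ℝ => β ⌊z.2⌋ (z.1, Int.fract z.2) := by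
  have hloc : LocallyFinite fun j : ℤ => {z : K × ℝ | z.2 ∈ Set.Icc (j : ℝ) (j + 1)} := by
    intro z
    refine ⟨Prod.snd ⁻¹' Metric.ball z.2 1,
      continuous_snd.continuousAt.preimage_mem_nhds (Metric.ball_mem_nhds _ one_pos),
      (Set.finite_Icc (⌊z.2⌋ - 3) (⌊z.2⌋ + 3)).subset ?_⟩
    rintro j ⟨w, ⟨h1, h2⟩, h3⟩
    rw [Set.mem_preimage, Metric.mem_ball, Real.dist_eq, abs_lt] at h3
    have h4 := Int.floor_le z.2
    have h5 := Int.lt_floor_add_one z.2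
    constructor
    · have : (⌊z.2⌋ : ℝ) - 3 < j := by linarith
      exact_mod_cast this.le
    · have : (j : ℝ) < ⌊z.2⌋ + 3 := by linarith
      exact_mod_cast this.le
  refine hloc.continuous ?_ (fun j => isClosed_Icc.preimage continuous_snd) fun j => ?_
  · refine Set.eq_univ_of_forall fun z => Set.mem_iUnion.2 ⟨⌊z.2⌋, ?_, ?_⟩
    · exact Int.floor_le _
    · exact (Int.lt_floor_add_one _).le
  · have hc : Continuous fun z : K × ℝ => β j (z.1, z.2 - j) :=
      (hβ j).comp (continuous_fst.prodMk (continuous_snd.sub continuous_const))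
    refine hc.continuousOn.congr ?_
    rintro ⟨u, t⟩ ⟨h1, h2⟩
    -- At the upper end of the slab the floor already selects piece j + 1, which agrees with piece j
    -- there by `hm`.
    rcases h2.lt_or_eq with h2 | h2
    · have : ⌊t⌋ = j := Int.floor_eq_iff.2 ⟨h1, h2⟩
      simp only [Int.fract, this]
    · have h3 : t = ((j + 1 : ℤ) : ℝ) := by push_cast; exact h2
      simp only [h3, Int.floor_intCast, Int.fract_intCast]
      rw [← hm]
      congr 2
      push_cast
      ring

/-- Half-open pieces of the columns over `K`. -/
abbrev HalfOpenColumns (K : Type*) : Set (K × ℝ) := Set.univ ×ˢ Set.Ico 0 1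

/-- Both pieces are run at double speed. Half-open columns put each seam into the later piece only,
so the images can be disjoint and injectivity follows piece by piece. -/
theorem exists_append_columns {B b : K × ℝ → X} (hB : Continuous B) (hb : Continuous b)
    (hm : ∀ u, B (u, 1) = b (u, 0)) (hBi : Set.InjOn B (HalfOpenColumns K))
    (hbi : Set.InjOn b (HalfOpenColumns K))
    (hd : Disjoint (B '' HalfOpenColumns K) (b '' HalfOpenColumns K)) :
    ∃ C : K × ℝ → X, Continuous C ∧ (∀ u, C (u, 0) = B (u, 0)) ∧ (∀ u, C (u, 1) = b (u, 1)) ∧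
      Set.InjOn C (HalfOpenColumns K) ∧
      C '' HalfOpenColumns K = B '' HalfOpenColumns K ∪ b '' HalfOpenColumns K := by
  classical
  let D : K × ℝ → X := fun z => if z.2 ≤ 1 / 2 then B (z.1, 2 * z.2) else b (z.1, 2 * z.2 - 1)
  have h1 : ∀ u t, t < 1 / 2 → D (u, t) = B (u, 2 * t) := fun u t ht => if_pos ht.le
  have h2 : ∀ u t, 1 / 2 ≤ t → D (u, t) = b (u, 2 * t - 1) := by
    intro u t ht
    rcases ht.eq_or_lt with rfl | ht
    · simp only [D, le_refl, if_true]
      norm_num [hm]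
    · exact if_neg (not_le.2 ht)
  refine ⟨D, ?_, ?_, ?_, ?_, ?_⟩
  · refine Continuous.if_le (hB.comp (by fun_prop)) (hb.comp (by fun_prop)) continuous_snd
      continuous_const ?_
    rintro ⟨u, t⟩ h
    simp only at h
    subst h
    norm_num [hm]
  · intro u
    rw [h1 u 0 (by norm_num), mul_zero]
  · intro u
    rw [h2 u 1 (by norm_num)]
    norm_num
  · rintro ⟨u, t⟩ ⟨-, ht0, ht1⟩ ⟨u', t'⟩ ⟨-, ht0', ht1'⟩ h
    simp only at ht0 ht1 ht0' ht1'
    rcases lt_or_ge t (1 / 2) with ht | ht <;> rcases lt_or_ge t' (1 / 2) with ht' | ht'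
    · rw [h1 u t ht, h1 u' t' ht'] at h
      have := hBi (show _ ∈ _ from ⟨trivial, by simp only; constructor <;> linarith⟩)
        (show _ ∈ _ from ⟨trivial, by simp only; constructor <;> linarith⟩) h
      simp only [Prod.mk.injEq] at this ⊢
      exact ⟨this.1, by linarith⟩
    · rw [h1 u t ht, h2 u' t' ht'] at h
      exact (Set.disjoint_left.1 hd ⟨_, ⟨trivial, by simp only; constructor <;> linarith⟩, rfl⟩
        ⟨_, ⟨trivial, by simp only; constructor <;> linarith⟩, h.symm⟩).elim
    · rw [h2 u t ht, h1 u' t' ht'] at h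
      exact (Set.disjoint_left.1 hd ⟨_, ⟨trivial, by simp only; constructor <;> linarith⟩, rfl⟩
        ⟨_, ⟨trivial, by simp only; constructor <;> linarith⟩, h⟩).elim
    · rw [h2 u t ht, h2 u' t' ht'] at h
      have := hbi (show _ ∈ _ from ⟨trivial, by simp only; constructor <;> linarith⟩)
        (show _ ∈ _ from ⟨trivial, by simp only; constructor <;> linarith⟩) h
      simp only [Prod.mk.injEq] at this ⊢
      exact ⟨this.1, by linarith⟩
  · ext p
    constructor
    · rintro ⟨⟨u, t⟩, ⟨-, ht0, ht1⟩, rfl⟩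
      simp only at ht0 ht1
      rcases lt_or_ge t (1 / 2) with ht | ht
      · rw [h1 u t ht]
        exact Or.inl ⟨_, ⟨trivial, by simp only; constructor <;> linarith⟩, rfl⟩
      · rw [h2 u t ht]
        exact Or.inr ⟨_, ⟨trivial, by simp only; constructor <;> linarith⟩, rfl⟩
    · rintro (⟨⟨u, t⟩, ⟨-, ht0, ht1⟩, rfl⟩ | ⟨⟨u, t⟩, ⟨-, ht0, ht1⟩, rfl⟩) <;>
        simp only at ht0 ht1
      · refine ⟨(u, t / 2), ⟨trivial, by simp only; constructor <;> linarith⟩, ?_⟩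
        rw [h1 _ _ (by linarith), mul_div_cancel₀ _ two_ne_zero]
      · refine ⟨(u, (t + 1) / 2), ⟨trivial, by simp only; constructor <;> linarith⟩, ?_⟩
        rw [h2 _ _ (by linarith), mul_div_cancel₀ _ two_ne_zero, add_sub_cancel_right]

theorem exists_concat_columns {N : ℕ} {b : Fin (N + 1) → K × ℝ → X} (hb : ∀ k, Continuous (b k))
    (hm : ∀ (k : Fin N) u, b k.castSucc (u, 1) = b k.succ (u, 0))
    (hi : ∀ k, Set.InjOn (b k) (HalfOpenColumns K))
    (hd : ∀ k l, k ≠ l → Disjoint (b k '' HalfOpenColumns K) (b l '' HalfOpenColumns K)) :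
    ∃ C : K × ℝ → X, Continuous C ∧ (∀ u, C (u, 0) = b 0 (u, 0)) ∧
      (∀ u, C (u, 1) = b (Fin.last N) (u, 1)) ∧ Set.InjOn C (HalfOpenColumns K) ∧
      C '' HalfOpenColumns K = ⋃ k, b k '' HalfOpenColumns K := by
  induction N with
  | zero =>
    refine ⟨b 0, hb 0, fun _ => rfl, fun _ => rfl, hi 0, ?_⟩
    ext p
    rw [Set.mem_iUnion]
    exact ⟨fun h => ⟨0, h⟩, fun ⟨i, h⟩ => by rwa [Fin.fin_one_eq_zero i] at h⟩
  | succ N ih =>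
    obtain ⟨B, hB, hB0, hB1, hBi, hBr⟩ := ih (b := fun k => b k.castSucc) (fun k => hb _)
      (fun k u => by simpa only [Fin.succ_castSucc] using hm k.castSucc u) (fun k => hi _)
      (fun k l h => hd _ _ fun h' => h (Fin.castSucc_injective _ h'))
    obtain ⟨C, hC, hC0, hC1, hCi, hCr⟩ := exists_append_columns hB (hb (Fin.last (N + 1)))
      (fun u => by rw [hB1, hm]; rfl) hBi (hi _) (by
        rw [hBr, Set.disjoint_iUnion_left]
        exact fun k => hd _ _ (Fin.castSucc_lt_last k).ne)
    refine ⟨C, hC, fun u => by rw [hC0, hB0]; rfl, hC1, hCi, ?_⟩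
    rw [hCr, hBr]
    ext p
    simp only [Set.mem_union, Set.mem_iUnion]
    exact (Fin.exists_fin_succ' (P := fun i => p ∈ b i '' HalfOpenColumns K)).symm

/-- A continuous map to a Hausdorff space from compact columns, whose only identifications are
periodic, is a local homeomorphism. -/
theorem isLocalHomeomorph_of_slabs [CompactSpace K] [T2Space X] {Φ : K × ℝ → X}
    (hΦ : Continuous Φ) {n : ℝ} (hn : 0 < n)
    (hslab : ∀ (a : ℝ) (p : X), ∃ z : K × ℝ, z.2 ∈ Set.Icc a (a + n) ∧ Φ z = p)
    (hinj : ∀ z z', Φ z = Φ z' → |z'.2 - z.2| < n → z = z') : IsLocalHomeomorph Φ := by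
  rw [isLocalHomeomorph_iff_isOpenEmbedding_restrict]
  intro z
  set a := z.2 - n / 2 with ha
  have hUo : IsOpen {w : K × ℝ | w.2 ∈ Set.Ioo a (a + n)} := isOpen_Ioo.preimage continuous_snd
  refine ⟨{w | w.2 ∈ Set.Ioo a (a + n)},
    hUo.mem_nhds (by constructor <;> simp only [ha] <;> linarith), ?_⟩
  refine .of_continuous_injective_isOpenMap (hΦ.comp continuous_subtype_val) ?_ ?_
  · rintro ⟨w, hw1, hw2⟩ ⟨w', hw1', hw2'⟩ h
    exact Subtype.ext (hinj _ _ h (by rw [abs_lt]; constructor <;> linarith))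
  · intro V hV
    set O : Set (K × ℝ) := Subtype.val '' V with hO
    have hOo : IsOpen O := hUo.isOpenMap_subtype_val V hV
    have hcomp : IsCompact ((Set.univ ×ˢ Set.Icc a (a + n)) \ O) :=
      (isCompact_univ.prod isCompact_Icc).diff hOo
    -- Every point of `X` has a preimage in the closed slab, and a point of `V`, lying in the open
    -- slab, shares its image with no other point of the closed one. Hence the image of `V` is the
    -- complement of a compact image.
    have : (Set.domRestrict {w : K × ℝ | w.2 ∈ Set.Ioo a (a + n)} Φ) '' V =
        (Φ '' ((Set.univ ×ˢ Set.Icc a (a + n)) \ O))ᶜ := by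
      ext p
      constructor
      · rintro ⟨⟨w, hw⟩, hwV, rfl⟩ ⟨w', ⟨⟨-, hw'⟩, hw'O⟩, h⟩
        have := hinj w' w h (by rw [abs_lt]; constructor <;> linarith [hw.1, hw.2, hw'.1, hw'.2])
        exact hw'O ⟨⟨w, hw⟩, hwV, this.symm⟩
      · intro hp
        obtain ⟨w, hw, rfl⟩ := hslab a p
        by_contra hcon
        refine hp ⟨w, ⟨⟨trivial, hw⟩, ?_⟩, rfl⟩
        rintro ⟨v, hv, rfl⟩
        exact hcon ⟨v, hv, rfl⟩
    rw [this]
    exact (hcomp.image hΦ).isClosed.isOpen_compl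

/-- Columns whose ends are identified by the homeomorphism `g`. -/
theorem exists_periodic_columns [CompactSpace K] [T2Space X] {B : K × ℝ → X} (hB : Continuous B)
    (g : K ≃ₜ K) (hm : ∀ u, B (u, 1) = B (g u, 0)) (hi : Set.InjOn B (HalfOpenColumns K)) :
    ∃ Φ : K × ℝ → B '' HalfOpenColumns K, IsLocalHomeomorph Φ ∧ Function.Surjective Φ ∧
      ∀ z z', Φ z = Φ z' → ∃ k : ℤ, z'.2 = z.2 + k ∧ z.1 = (g ^ k) z'.1 := by
  -- Each crossing of an integer height applies `g` once more, which is what the seam condition `hm`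
  -- requires.
  let Ψ : K × ℝ → X := fun z => B ((g ^ ⌊z.2⌋) z.1, Int.fract z.2)
  have hΨ : Continuous Ψ := continuous_glue_int (β := fun j z => B ((g ^ j) z.1, z.2))
    (fun j => hB.comp (((g ^ j).continuous.comp continuous_fst).prodMk continuous_snd))
    (fun j u => by rw [hm, add_comm, zpow_one_add]; rfl)
  have hmem : ∀ z, Ψ z ∈ B '' HalfOpenColumns K := fun z =>
    ⟨_, ⟨trivial, Int.fract_nonneg _, Int.fract_lt_one _⟩, rfl⟩
  have hfib : ∀ z z', Ψ z = Ψ z' → ∃ k : ℤ, z'.2 = z.2 + k ∧ z.1 = (g ^ k) z'.1 := by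
    intro z z' h
    have := hi ⟨trivial, Int.fract_nonneg _, Int.fract_lt_one _⟩
      ⟨trivial, Int.fract_nonneg _, Int.fract_lt_one _⟩ h
    rw [Prod.mk.injEq] at this
    refine ⟨⌊z'.2⌋ - ⌊z.2⌋, ?_, ?_⟩
    · have h1 := Int.floor_add_fract z.2
      have h2 := Int.floor_add_fract z'.2
      push_cast
      linarith [this.2]
    · have h3 : z.1 = (g ^ (-⌊z.2⌋)) ((g ^ ⌊z.2⌋) z.1) := by
        change z.1 = (g ^ (-⌊z.2⌋) * g ^ ⌊z.2⌋) z.1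
        rw [← zpow_add, neg_add_cancel]
        rfl
      rw [h3, this.1, sub_eq_neg_add, zpow_add]
      rfl
  have hper : ∀ (k : ℤ) u t, Ψ (u, t + k) = Ψ ((g ^ k) u, t) := by
    intro k u t
    simp only [Ψ, Int.floor_add_intCast, Int.fract_add_intCast, zpow_add]
    rfl
  have hsurj : ∀ p ∈ B '' HalfOpenColumns K, ∃ z, Ψ z = p := by
    rintro _ ⟨⟨u, t⟩, ⟨-, ht⟩, rfl⟩
    refine ⟨(u, t), ?_⟩
    have h0 : ⌊t⌋ = 0 := Int.floor_eq_zero_iff.2 ht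
    have h1 : Int.fract t = t := Int.fract_eq_self.2 ht
    simp only [Ψ, h0, h1, zpow_zero]
    rfl
  refine ⟨fun z => ⟨Ψ z, hmem z⟩, ?_, ?_, fun z z' h => hfib z z' (congrArg Subtype.val h)⟩
  · refine isLocalHomeomorph_of_slabs (hΨ.subtype_mk _) one_pos ?_ ?_
    · rintro a ⟨p, hp⟩
      obtain ⟨⟨u, t⟩, rfl⟩ := hsurj p hp
      refine ⟨((g ^ ⌊t - a⌋) u, a + Int.fract (t - a)), ?_, ?_⟩
      · constructor <;> simp only <;>
          linarith [Int.fract_nonneg (t - a), Int.fract_lt_one (t - a)]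
      · apply Subtype.ext
        simp only
        rw [← hper]
        congr 2
        linarith [Int.floor_add_fract (t - a)]
    · intro z z' h hlt
      obtain ⟨k, hk, hk'⟩ := hfib z z' (congrArg Subtype.val h)
      rw [hk, add_sub_cancel_left] at hlt
      have : k = 0 := Int.abs_lt_one_iff.1 (by exact_mod_cast hlt)
      subst this
      rw [Int.cast_zero, add_zero] at hk
      exact Prod.ext hk' hk.symm
  · rintro ⟨p, hp⟩
    obtain ⟨z, rfl⟩ := hsurj p hp
    exact ⟨z, rfl⟩

end Columns

/-! ### Joining caps to connecting pieces, and columns with infinite ends -/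

section Joins

variable {K X : Type*} [TopologicalSpace K] [TopologicalSpace X]

/-- Columns of variable height `a`, followed by columns of height one. -/
theorem exists_join_columns {a : K → ℝ} (ha : Continuous a) (ha0 : ∀ u, 0 ≤ a u)
    {P g : K × ℝ → X} (hP : Continuous P) (hg : Continuous g) (hm : ∀ u, P (u, a u) = g (u, 0))
    (hPi : Set.InjOn P {z | z.2 ∈ Set.Icc 0 (a z.1)})
    (hgi : Set.InjOn g (Set.univ ×ˢ Set.Ioo 0 1))
    (hd : Disjoint (P '' {z | z.2 ∈ Set.Icc 0 (a z.1)}) (g '' (Set.univ ×ˢ Set.Ioo 0 1))) :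
    ∃ C : K × ℝ → X, Continuous C ∧ (∀ u, C (u, 0) = P (u, 0)) ∧ (∀ u, C (u, 1) = g (u, 1)) ∧
      Set.InjOn C (HalfOpenColumns K) ∧ C '' HalfOpenColumns K =
        P '' {z | z.2 ∈ Set.Icc 0 (a z.1)} ∪ g '' (Set.univ ×ˢ Set.Ioo 0 1) := by
  classical
  -- The total height `a u + 1` is rescaled to one. It stays positive even where `a u = 0`, as
  -- happens over the edge of the hemisphere when both rim parts of a cap are full halves.
  let D : K × ℝ → X := fun z => if z.2 * (a z.1 + 1) ≤ a z.1 then P (z.1, z.2 * (a z.1 + 1))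
    else g (z.1, z.2 * (a z.1 + 1) - a z.1)
  have h1 : ∀ u t, t * (a u + 1) ≤ a u → D (u, t) = P (u, t * (a u + 1)) := fun u t ht => if_pos ht
  have h2 : ∀ u t, a u < t * (a u + 1) → D (u, t) = g (u, t * (a u + 1) - a u) :=
    fun u t ht => if_neg (not_le.2 ht)
  have hpos : ∀ u, 0 < a u + 1 := fun u => by linarith [ha0 u]
  have hI : ∀ u t, t ∈ Set.Ico (0 : ℝ) 1 → 0 ≤ t * (a u + 1) ∧ t * (a u + 1) - a u < 1 := by
    intro u t ht
    have := mul_lt_mul_of_pos_right ht.2 (hpos u)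
    exact ⟨mul_nonneg ht.1 (hpos u).le, by linarith⟩
  refine ⟨D, ?_, ?_, ?_, ?_, ?_⟩
  · refine Continuous.if_le (hP.comp (by fun_prop)) (hg.comp (by fun_prop)) (by fun_prop)
      (by fun_prop) ?_
    rintro ⟨u, t⟩ h
    simp only at h ⊢
    rw [h, hm, sub_self]
  · intro u
    rw [h1 u 0 (by rw [zero_mul]; exact ha0 u), zero_mul]
  · intro u
    rw [h2 u 1 (by linarith), one_mul, add_sub_cancel_left]
  · rintro ⟨u, t⟩ ⟨-, ht⟩ ⟨u', t'⟩ ⟨-, ht'⟩ h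
    simp only at ht ht'
    have hr := hI u t ht
    have hr' := hI u' t' ht'
    rcases le_or_gt (t * (a u + 1)) (a u) with hc | hc <;>
      rcases le_or_gt (t' * (a u' + 1)) (a u') with hc' | hc'
    · rw [h1 u t hc, h1 u' t' hc'] at h
      have := hPi (show _ ∈ _ from ⟨hr.1, hc⟩) (show _ ∈ _ from ⟨hr'.1, hc'⟩) h
      rw [Prod.mk.injEq] at this
      obtain ⟨rfl, this⟩ := this
      exact Prod.ext rfl (mul_right_cancel₀ (hpos u).ne' this)
    · rw [h1 u t hc, h2 u' t' hc'] at h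
      exact (Set.disjoint_left.1 hd ⟨_, ⟨hr.1, hc⟩, rfl⟩
        ⟨_, ⟨trivial, sub_pos.2 hc', hr'.2⟩, h.symm⟩).elim
    · rw [h2 u t hc, h1 u' t' hc'] at h
      exact (Set.disjoint_left.1 hd ⟨_, ⟨hr'.1, hc'⟩, rfl⟩
        ⟨_, ⟨trivial, sub_pos.2 hc, hr.2⟩, h⟩).elim
    · rw [h2 u t hc, h2 u' t' hc'] at h
      have := hgi (show _ ∈ _ from ⟨trivial, sub_pos.2 hc, hr.2⟩)
        (show _ ∈ _ from ⟨trivial, sub_pos.2 hc', hr'.2⟩) h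
      rw [Prod.mk.injEq] at this
      obtain ⟨rfl, this⟩ := this
      exact Prod.ext rfl (mul_right_cancel₀ (hpos u).ne' (sub_left_injective this))
  · ext p
    constructor
    · rintro ⟨⟨u, t⟩, ⟨-, ht⟩, rfl⟩
      have hr := hI u t ht
      rcases le_or_gt (t * (a u + 1)) (a u) with hc | hc
      · rw [h1 u t hc]
        exact Or.inl ⟨_, ⟨hr.1, hc⟩, rfl⟩
      · rw [h2 u t hc]
        exact Or.inr ⟨_, ⟨trivial, sub_pos.2 hc, hr.2⟩, rfl⟩
    · rintro (⟨⟨u, t⟩, ht, rfl⟩ | ⟨⟨u, t⟩, ⟨-, ht⟩, rfl⟩)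
      · have ht0 : 0 ≤ t := ht.1
        have ht1 : t ≤ a u := ht.2
        have hc := div_mul_cancel₀ t (hpos u).ne'
        refine ⟨(u, t / (a u + 1)), ⟨trivial, div_nonneg ht0 (hpos u).le, ?_⟩, ?_⟩
        · exact (div_lt_one (hpos u)).2 (by linarith)
        · rw [h1 _ _ (hc.trans_le ht1), hc]
      · have ht0 : 0 < t := ht.1
        have ht1 : t < 1 := ht.2
        have hc := div_mul_cancel₀ (t + a u) (hpos u).ne'
        refine ⟨(u, (t + a u) / (a u + 1)),
          ⟨trivial, div_nonneg (by linarith [ha0 u]) (hpos u).le, ?_⟩, ?_⟩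
        · exact (div_lt_one (hpos u)).2 (by linarith)
        · rw [h2 _ _ (by rw [hc]; linarith), hc, add_sub_cancel_right]

/-- Columns which are continued by half-infinite ones at both ends. -/
theorem exists_line_columns {B S₀ S₁ : K × ℝ → X} (hB : Continuous B) (hS₀ : Continuous S₀)
    (hS₁ : Continuous S₁) (hm₀ : ∀ u, S₀ (u, 0) = B (u, 0)) (hm₁ : ∀ u, B (u, 1) = S₁ (u, 0))
    (hBi : Set.InjOn B (HalfOpenColumns K)) (hi₀ : Set.InjOn S₀ (Set.univ ×ˢ Set.Ioi 0))
    (hi₁ : Set.InjOn S₁ (Set.univ ×ˢ Set.Ici 0))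
    (hd₀ : Disjoint (B '' HalfOpenColumns K) (S₀ '' (Set.univ ×ˢ Set.Ioi 0)))
    (hd₁ : Disjoint (B '' HalfOpenColumns K) (S₁ '' (Set.univ ×ˢ Set.Ici 0)))
    (hd : Disjoint (S₀ '' (Set.univ ×ˢ Set.Ioi 0)) (S₁ '' (Set.univ ×ˢ Set.Ici 0))) :
    ∃ Φ : K × ℝ → X, Continuous Φ ∧ Function.Injective Φ ∧
      Set.range Φ = B '' HalfOpenColumns K ∪ S₀ '' (Set.univ ×ˢ Set.Ioi 0) ∪
        S₁ '' (Set.univ ×ˢ Set.Ici 0) ∧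
      (∀ u t, t < 0 → Φ (u, t) = S₀ (u, -t)) ∧ (∀ u t, 1 ≤ t → Φ (u, t) = S₁ (u, t - 1)) := by
  classical
  -- `S₀` is traversed backwards, so that each line comes in from the far end of `S₀`.
  let Φ : K × ℝ → X := fun z => if z.2 ≤ 0 then S₀ (z.1, -z.2) else
    if z.2 ≤ 1 then B z else S₁ (z.1, z.2 - 1)
  have h0 : ∀ u t, t < 0 → Φ (u, t) = S₀ (u, -t) := fun u t ht => if_pos ht.le
  have h1 : ∀ u t, t ∈ Set.Ico (0 : ℝ) 1 → Φ (u, t) = B (u, t) := by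
    rintro u t ⟨ht0, ht1⟩
    rcases ht0.eq_or_lt with rfl | ht0
    · simp only [Φ, le_refl, if_true, neg_zero, hm₀]
    · simp only [Φ, not_le.2 ht0, ht1.le, if_true, if_false]
  have h2 : ∀ u t, 1 ≤ t → Φ (u, t) = S₁ (u, t - 1) := by
    intro u t ht
    rcases ht.eq_or_lt with rfl | ht'
    · simp [Φ, hm₁, not_le.2 (zero_lt_one' ℝ)]
    · simp only [Φ, not_le.2 ht', not_le.2 (one_pos.trans ht'), if_false]
  have hcases : ∀ t : ℝ, t < 0 ∨ t ∈ Set.Ico (0 : ℝ) 1 ∨ 1 ≤ t := by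
    intro t
    rcases lt_or_ge t 0 with h | h
    · exact Or.inl h
    rcases lt_or_ge t 1 with h' | h'
    · exact Or.inr (Or.inl ⟨h, h'⟩)
    · exact Or.inr (Or.inr h')
  refine ⟨Φ, ?_, ?_, ?_, h0, h2⟩
  · refine Continuous.if_le (hS₀.comp (by fun_prop)) (Continuous.if_le hB (hS₁.comp (by fun_prop))
      continuous_snd continuous_const ?_) continuous_snd continuous_const ?_
    · rintro ⟨u, t⟩ h
      simp only at h
      simp only [h, hm₁, sub_self]
    · rintro ⟨u, t⟩ h
      simp only at h
      simp only [h, neg_zero, hm₀, zero_le_one, if_true]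
  · have hS0 : ∀ u t, t < 0 → Φ (u, t) ∈ S₀ '' (Set.univ ×ˢ Set.Ioi 0) := fun u t ht => by
      rw [h0 u t ht]; exact ⟨(u, -t), ⟨trivial, neg_pos.2 ht⟩, rfl⟩
    have hSB : ∀ u t, t ∈ Set.Ico (0 : ℝ) 1 → Φ (u, t) ∈ B '' HalfOpenColumns K := fun u t ht => by
      rw [h1 u t ht]; exact ⟨_, ⟨trivial, ht⟩, rfl⟩
    have hS1 : ∀ u t, 1 ≤ t → Φ (u, t) ∈ S₁ '' (Set.univ ×ˢ Set.Ici 0) := fun u t ht => by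
      rw [h2 u t ht]; exact ⟨(u, t - 1), ⟨trivial, sub_nonneg.2 ht⟩, rfl⟩
    rintro ⟨u, t⟩ ⟨u', t'⟩ h
    rcases hcases t with ht | ht | ht <;> rcases hcases t' with ht' | ht' | ht'
    · rw [h0 u t ht, h0 u' t' ht'] at h
      have := hi₀ (x₁ := (u, -t)) (x₂ := (u', -t')) ⟨trivial, neg_pos.2 ht⟩
        ⟨trivial, neg_pos.2 ht'⟩ h
      rw [Prod.mk.injEq] at this
      exact Prod.ext this.1 (neg_injective this.2)
    · exact (Set.disjoint_left.1 hd₀ (hSB u' t' ht') (h ▸ hS0 u t ht)).elim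
    · exact (Set.disjoint_left.1 hd (h ▸ hS0 u t ht) (hS1 u' t' ht')).elim
    · exact (Set.disjoint_left.1 hd₀ (h ▸ hSB u t ht) (hS0 u' t' ht')).elim
    · rw [h1 u t ht, h1 u' t' ht'] at h
      exact hBi ⟨trivial, ht⟩ ⟨trivial, ht'⟩ h
    · exact (Set.disjoint_left.1 hd₁ (h ▸ hSB u t ht) (hS1 u' t' ht')).elim
    · exact (Set.disjoint_left.1 hd (hS0 u' t' ht') (h ▸ hS1 u t ht)).elim
    · exact (Set.disjoint_left.1 hd₁ (hSB u' t' ht') (h ▸ hS1 u t ht)).elim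
    · rw [h2 u t ht, h2 u' t' ht'] at h
      have := hi₁ (x₁ := (u, t - 1)) (x₂ := (u', t' - 1)) ⟨trivial, sub_nonneg.2 ht⟩
        ⟨trivial, sub_nonneg.2 ht'⟩ h
      rw [Prod.mk.injEq] at this
      exact Prod.ext this.1 (sub_left_injective this.2)
  · ext p
    constructor
    · rintro ⟨⟨u, t⟩, rfl⟩
      rcases hcases t with ht | ht | ht
      · rw [h0 u t ht]
        exact Or.inl (Or.inr ⟨(u, -t), ⟨trivial, neg_pos.2 ht⟩, rfl⟩)
      · rw [h1 u t ht]
        exact Or.inl (Or.inl ⟨_, ⟨trivial, ht⟩, rfl⟩)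
      · rw [h2 u t ht]
        exact Or.inr ⟨(u, t - 1), ⟨trivial, sub_nonneg.2 ht⟩, rfl⟩
    · rintro ((⟨⟨u, t⟩, ⟨-, ht⟩, rfl⟩ | ⟨⟨u, t⟩, ⟨-, ht⟩, rfl⟩) | ⟨⟨u, t⟩, ⟨-, ht⟩, rfl⟩)
      · exact ⟨(u, t), h1 u t ht⟩
      · exact ⟨(u, -t), by rw [h0 u (-t) (neg_neg_iff_pos.2 ht), neg_neg]⟩
      · exact ⟨(u, t + 1), by
          rw [h2 u (t + 1) (le_add_of_nonneg_left ht), add_sub_cancel_right]⟩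

/-- Preimages of bounded sets have bounded height and `K` is compact, so the map is proper. This
keeps the infinite ends from accumulating on the rest of the hypersurface. -/
theorem isClosedEmbedding_of_norm_unbounded [CompactSpace K] {V : Type*} [NormedAddCommGroup V]
    [ProperSpace V] {Φ : K × ℝ → V} (hΦ : Continuous Φ) (hi : Function.Injective Φ)
    (hn : ∀ r : ℝ, ∃ T : ℝ, ∀ u t, T ≤ |t| → r < ‖Φ (u, t)‖) : Topology.IsClosedEmbedding Φ := by
  have hp : IsProperMap Φ := by
    rw [isProperMap_iff_tendsto_cocompact]
    refine ⟨hΦ, Filter.hasBasis_cocompact.tendsto_right_iff.2 fun s hs => ?_⟩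
    obtain ⟨r, hr⟩ := hs.isBounded.exists_norm_le
    obtain ⟨T, hT⟩ := hn r
    filter_upwards [(isCompact_univ.prod (isCompact_Icc (a := -T) (b := T))).compl_mem_cocompact]
      with z hz hzs
    have h1 : T < |z.2| := by
      by_contra hcon
      exact hz ⟨trivial, abs_le.1 (not_lt.1 hcon)⟩
    exact absurd (hr _ hzs) (not_le.2 (hT z.1 z.2 h1.le))
  exact .of_continuous_injective_isClosedMap hΦ hi hp.isClosedMap

end Joins

/-! ### Columns filling the unit ball -/

section BallColumns

variable {m : ℕ} [NeZero m]

/-- The axis of the hemisphere. -/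
noncomputable def axis (m : ℕ) [NeZero m] : EuclideanSpace ℝ (Fin m) := EuclideanSpace.single 0 1

theorem axis_zero : axis m 0 = 1 := by simp [axis]

theorem norm_axis : ‖axis m‖ = 1 := by simp [axis]

theorem inner_axis (x : EuclideanSpace ℝ (Fin m)) : ⟪axis m, x⟫ = x 0 := by
  simp [axis, EuclideanSpace.inner_single_left]

/-- The component orthogonal to the axis. -/
noncomputable def hor (x : EuclideanSpace ℝ (Fin m)) : EuclideanSpace ℝ (Fin m) := x - x 0 • axis m

theorem hor_zero (x : EuclideanSpace ℝ (Fin m)) : hor x 0 = 0 := by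
  simp [hor, axis_zero]

theorem axis_add_hor (x : EuclideanSpace ℝ (Fin m)) : x 0 • axis m + hor x = x := by
  simp [hor]

theorem smul_axis_add_zero {v : EuclideanSpace ℝ (Fin m)} (hv : v 0 = 0) (y : ℝ) :
    (y • axis m + v) 0 = y := by
  simp [hv, axis_zero]

theorem hor_smul_axis_add {v : EuclideanSpace ℝ (Fin m)} (hv : v 0 = 0) (y : ℝ) :
    hor (y • axis m + v) = v := by
  rw [hor, smul_axis_add_zero hv, add_sub_cancel_left]

theorem norm_sq_smul_axis_add {v : EuclideanSpace ℝ (Fin m)} (hv : v 0 = 0) (y : ℝ) :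
    ‖y • axis m + v‖ ^ 2 = y ^ 2 + ‖v‖ ^ 2 := by
  rw [norm_add_sq_real, inner_smul_left, inner_axis, hv, norm_smul, norm_axis]
  simp

theorem norm_sq_hor (x : EuclideanSpace ℝ (Fin m)) : ‖hor x‖ ^ 2 = ‖x‖ ^ 2 - x 0 ^ 2 := by
  have := norm_sq_smul_axis_add (hor_zero x) (x 0)
  rw [axis_add_hor] at this
  linarith

@[fun_prop]
theorem continuous_hor : Continuous (hor : EuclideanSpace ℝ (Fin m) → _) := by
  unfold hor
  fun_prop

theorem smul_hor_zero (a : ℝ) (x : EuclideanSpace ℝ (Fin m)) : (a • hor x) 0 = 0 := by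
  simp [hor_zero]

theorem Hemi.norm_sq_hor (u : Hemi m) : ‖hor u.1‖ ^ 2 = 1 - u.1 0 ^ 2 := by
  rw [_root_.norm_sq_hor, u.2.1, one_pow]

/-- The height of a point of the hemisphere is the nonnegative root of 1 - ‖hor u‖², so the
horizontal part determines the point. -/
theorem Hemi.hor_injective : Function.Injective fun u : Hemi m => hor u.1 := by
  intro u v h
  simp only at h
  have h1 := Hemi.norm_sq_hor u
  rw [h, Hemi.norm_sq_hor v] at h1
  have h2 : u.1 0 = v.1 0 := by
    rw [← Real.sqrt_sq u.2.2, ← Real.sqrt_sq v.2.2]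
    congr 1
    linarith
  apply Subtype.ext
  rw [← axis_add_hor u.1, ← axis_add_hor v.1, h, h2]

theorem Hemi.exists_hor_eq {v : EuclideanSpace ℝ (Fin m)} (hv : v 0 = 0) (hv1 : ‖v‖ ^ 2 ≤ 1) :
    ∃ u : Hemi m, hor u.1 = v := by
  refine ⟨⟨√(1 - ‖v‖ ^ 2) • axis m + v, ?_, ?_⟩, hor_smul_axis_add hv _⟩
  · have := norm_sq_smul_axis_add hv (√(1 - ‖v‖ ^ 2))
    rw [Real.sq_sqrt (by linarith), sub_add_cancel] at this
    exact (sq_eq_sq₀ (norm_nonneg _) zero_le_one).1 (by rw [this, one_pow])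
  · rw [smul_axis_add_zero hv]
    exact Real.sqrt_nonneg _

instance : CompactSpace (Hemi m) := by
  rw [← isCompact_iff_compactSpace]
  refine (isCompact_sphere (0 : EuclideanSpace ℝ (Fin m)) 1).of_isClosed_subset ?_ ?_
  · exact (isClosed_eq continuous_norm continuous_const).inter
      (isClosed_le continuous_const
        (by fun_prop : Continuous fun u : EuclideanSpace ℝ (Fin m) => u 0))
  · exact fun u hu => mem_sphere_zero_iff_norm.2 hu.1

/-- Height of the point of the round part `{x | c ≤ x 0}` of the sphere that corresponds to `u`. -/
noncomputable def roundHeight (c : ℝ) (u : EuclideanSpace ℝ (Fin m)) : ℝ :=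
  √(c ^ 2 + (1 - c ^ 2) * u 0 ^ 2)

/-- The radial map from the hemisphere to the round part `{x | c ≤ x 0}` of the sphere. -/
noncomputable def roundPt (c : ℝ) (u : EuclideanSpace ℝ (Fin m)) : EuclideanSpace ℝ (Fin m) :=
  roundHeight c u • axis m + √(1 - c ^ 2) • hor u

/-- The reflection that reverses the axis. -/
noncomputable def axisRefl (x : EuclideanSpace ℝ (Fin m)) : EuclideanSpace ℝ (Fin m) :=
  x - (2 * x 0) • axis m

theorem axisRefl_smul_axis_add {v : EuclideanSpace ℝ (Fin m)} (hv : v 0 = 0) (y : ℝ) :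
    axisRefl (y • axis m + v) = (-y) • axis m + v := by
  rw [axisRefl, smul_axis_add_zero hv]
  module

theorem axisRefl_axisRefl (x : EuclideanSpace ℝ (Fin m)) : axisRefl (axisRefl x) = x := by
  conv_lhs => rw [← axis_add_hor x, axisRefl_smul_axis_add (hor_zero x),
    axisRefl_smul_axis_add (hor_zero x), neg_neg, axis_add_hor]

theorem axisRefl_apply_zero (x : EuclideanSpace ℝ (Fin m)) : axisRefl x 0 = -x 0 := by
  simp [axisRefl, axis_zero]
  ring

theorem norm_axisRefl (x : EuclideanSpace ℝ (Fin m)) : ‖axisRefl x‖ = ‖x‖ := by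
  have h1 : ‖axisRefl x‖ ^ 2 = ‖x‖ ^ 2 := by
    conv_lhs => rw [← axis_add_hor x, axisRefl_smul_axis_add (hor_zero x),
      norm_sq_smul_axis_add (hor_zero x), norm_sq_hor]
    ring
  exact (sq_eq_sq₀ (norm_nonneg _) (norm_nonneg _)).1 h1

@[fun_prop]
theorem continuous_axisRefl : Continuous (axisRefl : EuclideanSpace ℝ (Fin m) → _) := by
  unfold axisRefl
  fun_prop

@[fun_prop]
theorem continuous_roundHeight (c : ℝ) :
    Continuous (roundHeight c : EuclideanSpace ℝ (Fin m) → ℝ) := by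
  unfold roundHeight
  fun_prop

@[fun_prop]
theorem continuous_roundPt (c : ℝ) : Continuous (roundPt c : EuclideanSpace ℝ (Fin m) → _) := by
  unfold roundPt
  fun_prop

theorem sq_lt_one_of_mem {c : ℝ} (hc : 0 ≤ c) (hc1 : c < 1) : c ^ 2 < 1 :=
  (sq_lt_one_iff₀ hc).2 hc1

theorem sq_roundHeight {c : ℝ} (hc : 0 ≤ c) (hc1 : c < 1) (u : EuclideanSpace ℝ (Fin m)) :
    roundHeight c u ^ 2 = c ^ 2 + (1 - c ^ 2) * u 0 ^ 2 :=
  Real.sq_sqrt (add_nonneg (sq_nonneg _)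
    (mul_nonneg (by linarith [sq_lt_one_of_mem hc hc1]) (sq_nonneg _)))

theorem le_roundHeight {c : ℝ} (hc : 0 ≤ c) (hc1 : c < 1) (u : EuclideanSpace ℝ (Fin m)) :
    c ≤ roundHeight c u := by
  refine Real.le_sqrt_of_sq_le (le_add_of_nonneg_right
    (mul_nonneg (by linarith [sq_lt_one_of_mem hc hc1]) (sq_nonneg _)))

theorem roundPt_zero (u : Hemi m) : roundPt 0 u.1 = u.1 := by
  rw [roundPt, roundHeight]
  simp only [ne_eq, OfNat.ofNat_ne_zero, not_false_eq_true, zero_pow, sub_zero, one_mul, zero_add,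
    Real.sqrt_one, one_smul, Real.sqrt_sq u.2.2, axis_add_hor]

theorem roundPt_apply_zero (c : ℝ) (u : EuclideanSpace ℝ (Fin m)) :
    roundPt c u 0 = roundHeight c u := smul_axis_add_zero (smul_hor_zero _ _) _

/-- `roundHeight c u` is the nonnegative root of 1 - (1 - c²)‖hor u‖². -/
theorem norm_roundPt {c : ℝ} (hc : 0 ≤ c) (hc1 : c < 1) (u : Hemi m) : ‖roundPt c u.1‖ = 1 := by
  have h1 := sq_lt_one_of_mem hc hc1
  have : ‖roundPt c u.1‖ ^ 2 = 1 := by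
    rw [roundPt, norm_sq_smul_axis_add (smul_hor_zero _ _), sq_roundHeight hc hc1, norm_smul,
      mul_pow, Real.norm_eq_abs, sq_abs, Real.sq_sqrt (by linarith), Hemi.norm_sq_hor]
    ring
  exact (sq_eq_sq₀ (norm_nonneg _) zero_le_one).1 (by rw [this, one_pow])

theorem roundPt_injective {c : ℝ} (hc : 0 ≤ c) (hc1 : c < 1) :
    Function.Injective fun u : Hemi m => roundPt c u.1 := by
  intro u v h
  have h1 : hor (roundPt c u.1) = hor (roundPt c v.1) := congrArg hor h
  rw [roundPt, roundPt, hor_smul_axis_add (smul_hor_zero _ _),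
    hor_smul_axis_add (smul_hor_zero _ _)] at h1
  exact Hemi.hor_injective (smul_right_injective _
    (Real.sqrt_pos.2 (by linarith [sq_lt_one_of_mem hc hc1])).ne' h1)

theorem exists_roundPt_eq {c : ℝ} (hc : 0 ≤ c) (hc1 : c < 1) {x : EuclideanSpace ℝ (Fin m)}
    (hx : ‖x‖ = 1) (hcx : c ≤ x 0) : ∃ u : Hemi m, roundPt c u.1 = x := by
  have h1 : 0 < 1 - c ^ 2 := by linarith [sq_lt_one_of_mem hc hc1]
  have hs := Real.sqrt_pos.2 h1
  have hn : ‖(√(1 - c ^ 2))⁻¹ • hor x‖ ^ 2 = (1 - x 0 ^ 2) / (1 - c ^ 2) := by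
    rw [norm_smul, mul_pow, Real.norm_eq_abs, sq_abs, inv_pow, Real.sq_sqrt h1.le, norm_sq_hor, hx]
    ring
  obtain ⟨u, hu⟩ := Hemi.exists_hor_eq (v := (√(1 - c ^ 2))⁻¹ • hor x) (smul_hor_zero _ _) (by
    rw [hn, div_le_one h1]
    nlinarith)
  refine ⟨u, ?_⟩
  have h2 := Hemi.norm_sq_hor u
  rw [hu, hn, div_eq_iff h1.ne'] at h2
  have h3 : roundHeight c u.1 = x 0 := by
    rw [roundHeight, ← Real.sqrt_sq (hc.trans hcx)]
    congr 1
    linarith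
  rw [roundPt, h3, hu, smul_smul, mul_inv_cancel₀ hs.ne', one_smul, axis_add_hor]

/-- Radius of the ball column at height `y`. -/
noncomputable def columnScale (c d y : ℝ) : ℝ := √(1 - (max (-c) (min y d)) ^ 2)

/-- The columns of the unit ball; they run from the round part `{x | x 0 ≤ -c}` of the sphere
to the round part `{x | d ≤ x 0}`, and sweep out the rest of the sphere too. -/
noncomputable def ballColumn (c d : ℝ) (u : EuclideanSpace ℝ (Fin m)) (y : ℝ) :
    EuclideanSpace ℝ (Fin m) := y • axis m + columnScale c d y • hor u

theorem continuous_ballColumn (c d : ℝ) :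
    Continuous fun z : EuclideanSpace ℝ (Fin m) × ℝ => ballColumn c d z.1 z.2 := by
  unfold ballColumn columnScale
  fun_prop

section

variable {c d : ℝ}

/-- The clamped height lies strictly between -1 and 1. The scale therefore never vanishes, which
keeps distinct columns apart even near the poles. -/
theorem columnScale_pos (hc : 0 ≤ c) (hc1 : c < 1) (hd1 : d < 1) (y : ℝ) :
    0 < columnScale c d y := by
  refine Real.sqrt_pos.2 ?_
  have h1 : max (-c) (min y d) < 1 := max_lt (by linarith) ((min_le_right _ _).trans_lt hd1)
  have h2 : -1 < max (-c) (min y d) := lt_max_of_lt_left (by linarith)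
  nlinarith

theorem sq_columnScale (hc : 0 ≤ c) (hc1 : c < 1) (hd1 : d < 1) (y : ℝ) :
    columnScale c d y ^ 2 = 1 - (max (-c) (min y d)) ^ 2 := by
  have := columnScale_pos hc hc1 hd1 y
  exact Real.sq_sqrt (Real.sqrt_pos.1 this).le

theorem ballColumn_injective (hc : 0 ≤ c) (hc1 : c < 1) (hd1 : d < 1) :
    Function.Injective fun z : Hemi m × ℝ => ballColumn c d z.1.1 z.2 := by
  rintro ⟨u, y⟩ ⟨v, y'⟩ h
  have h0 := congrArg (fun x : EuclideanSpace ℝ (Fin m) => x 0) h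
  have h1 := congrArg hor h
  simp only [ballColumn] at h0 h1
  rw [smul_axis_add_zero (smul_hor_zero _ _), smul_axis_add_zero (smul_hor_zero _ _)] at h0
  rw [hor_smul_axis_add (smul_hor_zero _ _), hor_smul_axis_add (smul_hor_zero _ _), h0] at h1
  exact Prod.ext (Hemi.hor_injective
    (smul_right_injective _ (columnScale_pos hc hc1 hd1 y').ne' h1)) h0

theorem ballColumn_top (hc : 0 ≤ c) (hd : 0 ≤ d) (hd1 : d < 1) (u : EuclideanSpace ℝ (Fin m)) :
    ballColumn c d u (roundHeight d u) = roundPt d u := by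
  have h := le_roundHeight hd hd1 u
  rw [ballColumn, roundPt, columnScale, min_eq_right h, max_eq_right (by linarith)]

theorem ballColumn_bot (hc : 0 ≤ c) (hc1 : c < 1) (hd : 0 ≤ d) (u : EuclideanSpace ℝ (Fin m)) :
    ballColumn c d u (-roundHeight c u) = axisRefl (roundPt c u) := by
  have h := le_roundHeight hc hc1 u
  rw [roundPt, axisRefl_smul_axis_add (smul_hor_zero _ _), ballColumn, columnScale,
    min_eq_left (by linarith), max_eq_left (by linarith), neg_sq]

/-- Below -c and above d the scale is constant, and the column reaches the sphere exactly at its end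
height. In between, the bound only uses ‖hor u‖ ≤ 1. -/
theorem norm_ballColumn_le (hc : 0 ≤ c) (hc1 : c < 1) (hd : 0 ≤ d) (hd1 : d < 1) (u : Hemi m)
    {y : ℝ} (hy : -roundHeight c u.1 ≤ y)
    (hy' : y ≤ roundHeight d u.1) : ‖ballColumn c d u.1 y‖ ≤ 1 := by
  have h1 := sq_roundHeight hc hc1 u.1
  have h2 := sq_roundHeight hd hd1 u.1
  have h3 := le_roundHeight hc hc1 u.1
  have h4 := le_roundHeight hd hd1 u.1
  have hu0 := sq_nonneg (u.1 0)
  have hu1 : 0 ≤ 1 - u.1 0 ^ 2 := by rw [← Hemi.norm_sq_hor]; positivity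
  have h5 : ‖ballColumn c d u.1 y‖ ^ 2 =
      y ^ 2 + (1 - (max (-c) (min y d)) ^ 2) * (1 - u.1 0 ^ 2) := by
    rw [ballColumn, norm_sq_smul_axis_add (smul_hor_zero _ _), norm_smul, mul_pow,
      Real.norm_eq_abs, sq_abs, sq_columnScale hc hc1 hd1, Hemi.norm_sq_hor]
  refine (sq_le_one_iff₀ (norm_nonneg _)).1 ?_
  rw [h5]
  rcases le_or_gt y (-c) with hyc | hyc
  · rw [min_eq_left (by linarith), max_eq_left hyc]
    have : y ^ 2 ≤ roundHeight c u.1 ^ 2 := sq_le_sq.2 (abs_le_abs_of_nonpos (by linarith) (by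
      linarith)) |>.trans_eq (neg_sq _)
    linarith
  · rcases le_or_gt y d with hyd | hyd
    · rw [min_eq_left hyd, max_eq_right hyc.le]
      have : y ^ 2 ≤ 1 := by nlinarith
      nlinarith
    · rw [min_eq_right hyd.le, max_eq_right (by linarith)]
      have : y ^ 2 ≤ roundHeight d u.1 ^ 2 := pow_le_pow_left₀ (by linarith) hy' 2
      linarith

/-- Clamping does not increase |x 0|, so `hor x` divided by the scale has norm at most one and is
the horizontal part of some u. -/
theorem exists_ballColumn_eq (hc : 0 ≤ c) (hc1 : c < 1) (hd : 0 ≤ d) (hd1 : d < 1)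
    {x : EuclideanSpace ℝ (Fin m)} (hx : ‖x‖ ≤ 1) :
    ∃ u : Hemi m, -roundHeight c u.1 ≤ x 0 ∧ x 0 ≤ roundHeight d u.1 ∧
      ballColumn c d u.1 (x 0) = x := by
  have hpos := columnScale_pos hc hc1 hd1 (x 0)
  have hsq := sq_columnScale hc hc1 hd1 (x 0)
  have hpos2 := pow_pos hpos 2
  have hh : ‖hor x‖ ^ 2 ≤ 1 - x 0 ^ 2 := by
    rw [norm_sq_hor]
    have := (sq_le_one_iff₀ (norm_nonneg x)).2 hx
    linarith
  have hle : ‖hor x‖ ^ 2 ≤ columnScale c d (x 0) ^ 2 := by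
    rw [hsq]
    have : (max (-c) (min (x 0) d)) ^ 2 ≤ x 0 ^ 2 := by
      rw [sq_le_sq]
      rcases le_total 0 (x 0) with h | h
      · rw [max_eq_right ((neg_nonpos.2 hc).trans (le_min h hd)), abs_of_nonneg (le_min h hd),
          abs_of_nonneg h]
        exact min_le_left _ _
      · rw [min_eq_left (h.trans hd), abs_of_nonpos h,
          abs_of_nonpos (max_le (neg_nonpos.2 hc) h)]
        exact neg_le_neg (le_max_right _ _)
    linarith
  have hn : ‖(columnScale c d (x 0))⁻¹ • hor x‖ ^ 2 =
      ‖hor x‖ ^ 2 / columnScale c d (x 0) ^ 2 := by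
    rw [norm_smul, mul_pow, Real.norm_eq_abs, sq_abs, inv_pow, div_eq_inv_mul]
  obtain ⟨u, hu⟩ := Hemi.exists_hor_eq (v := (columnScale c d (x 0))⁻¹ • hor x)
    (smul_hor_zero _ _) (by rwa [hn, div_le_one hpos2])
  have h2 := Hemi.norm_sq_hor u
  rw [hu, hn, div_eq_iff hpos2.ne'] at h2
  refine ⟨u, ?_, ?_, ?_⟩
  · rcases le_or_gt (-c) (x 0) with h | h
    · linarith [le_roundHeight hc hc1 u.1]
    · rw [min_eq_left (by linarith), max_eq_left h.le, neg_sq] at hsq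
      rw [hsq] at h2
      rw [neg_le]
      refine Real.le_sqrt_of_sq_le ?_
      linarith
  · rcases le_or_gt (x 0) d with h | h
    · linarith [le_roundHeight hd hd1 u.1]
    · rw [min_eq_right h.le, max_eq_right (by linarith)] at hsq
      rw [hsq] at h2
      refine Real.le_sqrt_of_sq_le ?_
      linarith
  · rw [ballColumn, hu, smul_smul, mul_inv_cancel₀ hpos.ne', one_smul, axis_add_hor]

end

section

variable {A : EuclideanSpace ℝ (Fin m) ≃ₗᵢ[ℝ] EuclideanSpace ℝ (Fin m)}

theorem apply_zero_of_fixes_axis (hA : A (axis m) = axis m) (x : EuclideanSpace ℝ (Fin m)) :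
    A x 0 = x 0 := by
  rw [← inner_axis, ← inner_axis, ← hA, A.inner_map_map, hA]

theorem roundPt_map (hA : A (axis m) = axis m) (c : ℝ) (u : EuclideanSpace ℝ (Fin m)) :
    roundPt c (A u) = A (roundPt c u) := by
  simp only [roundPt, roundHeight, hor, apply_zero_of_fixes_axis hA, map_add, map_smul, map_sub, hA]

end

/-- The action on the hemisphere of an isometry that fixes the axis. -/
noncomputable def hemiMap (A : EuclideanSpace ℝ (Fin m) ≃ₗᵢ[ℝ] EuclideanSpace ℝ (Fin m))
    (hA : A (axis m) = axis m) : Hemi m ≃ₜ Hemi m where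
  toFun u := ⟨A u.1, by rw [A.norm_map]; exact u.2.1, by
    rw [apply_zero_of_fixes_axis hA]; exact u.2.2⟩
  invFun u := ⟨A.symm u.1, by rw [A.symm.norm_map]; exact u.2.1, by
    rw [← apply_zero_of_fixes_axis hA, A.apply_symm_apply]; exact u.2.2⟩
  left_inv u := Subtype.ext (A.symm_apply_apply _)
  right_inv u := Subtype.ext (A.apply_symm_apply _)
  continuous_toFun := (A.continuous.comp continuous_subtype_val).subtype_mk _
  continuous_invFun := (A.symm.continuous.comp continuous_subtype_val).subtype_mk _

theorem coe_hemiMap_zpow (A : EuclideanSpace ℝ (Fin m) ≃ₗᵢ[ℝ] EuclideanSpace ℝ (Fin m))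
    (hA : A (axis m) = axis m) (k : ℤ) (u : Hemi m) :
    ((hemiMap A hA ^ k) u).1 = (A ^ k) u.1 := by
  induction k using Int.induction_on generalizing u with
  | zero => rfl
  | succ i ih =>
    rw [zpow_add_one, zpow_add_one]
    exact ih _
  | pred i ih =>
    rw [zpow_sub_one, zpow_sub_one]
    exact ih _

end BallColumns

/-! ### Caps as radial images of the tangent unit ball -/

namespace HyperCaps

variable {m n : ℕ} (K : HyperCaps m n)

theorem radius_smul_normal (i : Fin n) :
    (K.S i).radius • K.normal i = K.x i - (K.S i).center := by
  rw [normal, smul_smul, mul_inv_cancel₀ (K.radius_pos i).ne', one_smul]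

theorem norm_normal (i : Fin n) : ‖K.normal i‖ = 1 := by
  have h : ‖K.x i - (K.S i).center‖ = (K.S i).radius := by
    rw [← dist_eq_norm]
    exact K.x_mem i
  rw [normal, norm_smul, h, norm_inv, Real.norm_of_nonneg (K.radius_pos i).le,
    inv_mul_cancel₀ (K.radius_pos i).ne']

/-- Radial parametrization of the cap by the unit ball of the tangent space. -/
noncomputable def capPt (i : Fin n) (b : Ambient m) : Ambient m :=
  K.x i - (K.δ ^ 2 * ‖b‖ ^ 2 / (2 * (K.S i).radius)) • K.normal i +
    (K.δ * √(1 - K.δ ^ 2 * ‖b‖ ^ 2 / (4 * (K.S i).radius ^ 2))) • b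

theorem continuous_capPt (i : Fin n) : Continuous (K.capPt i) := by
  unfold capPt
  fun_prop

theorem capPt_eq_rimPt (i : Fin n) {u : Ambient m} (hu : ‖u‖ = 1) :
    K.capPt i u = K.rimPt i u := by
  rw [capPt, rimPt, rimCenter, rimRadius, hu, one_pow, mul_one]

theorem cap_ratio_lt_one (i : Fin n) {s : ℝ} (hs : s ≤ K.δ ^ 2) :
    s / (4 * (K.S i).radius ^ 2) < 1 := by
  have h1 := K.radius_pos i
  rw [div_lt_one (by positivity)]
  have := K.δ_lt i
  have h2 := K.δ_pos
  nlinarith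

theorem cap_ratio_lt_one' (i : Fin n) {b : Ambient m} (hb : ‖b‖ ≤ 1) :
    K.δ ^ 2 * ‖b‖ ^ 2 / (4 * (K.S i).radius ^ 2) < 1 := by
  refine K.cap_ratio_lt_one i (mul_le_of_le_one_right (sq_nonneg _) ?_)
  exact (sq_le_one_iff₀ (norm_nonneg b)).2 hb

theorem norm_sq_smul_normal_add (i : Fin n) {b : Ambient m} (hb : ⟪K.normal i, b⟫ = 0) (y : ℝ) :
    ‖y • K.normal i + b‖ ^ 2 = y ^ 2 + ‖b‖ ^ 2 := by
  rw [norm_add_sq_real, inner_smul_left, hb, norm_smul, norm_normal]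
  simp

/-- A point of a sphere of radius R at chord distance s from `x i` lies s²/(2R) below the tangent
hyperplane and s√(1 - s²/(4R²)) away from the normal line. `capPt` realizes this with s = δ‖b‖. -/
theorem capPt_mem_cap (i : Fin n) {b : Ambient m} (hb : ⟪K.normal i, b⟫ = 0) (hb1 : ‖b‖ ≤ 1) :
    K.capPt i b ∈ K.cap i := by
  have hR := K.radius_pos i
  have hs : √(1 - K.δ ^ 2 * ‖b‖ ^ 2 / (4 * (K.S i).radius ^ 2)) ^ 2 =
      1 - K.δ ^ 2 * ‖b‖ ^ 2 / (4 * (K.S i).radius ^ 2) :=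
    Real.sq_sqrt (by linarith [K.cap_ratio_lt_one' i hb1])
  set r := √(1 - K.δ ^ 2 * ‖b‖ ^ 2 / (4 * (K.S i).radius ^ 2)) with hr
  have hb' : ⟪K.normal i, (K.δ * r) • b⟫ = 0 := by rw [inner_smul_right, hb, mul_zero]
  have hn : ‖(K.δ * r) • b‖ ^ 2 =
      K.δ ^ 2 * ‖b‖ ^ 2 * (1 - K.δ ^ 2 * ‖b‖ ^ 2 / (4 * (K.S i).radius ^ 2)) := by
    rw [norm_smul, mul_pow, Real.norm_eq_abs, sq_abs, mul_pow, hs]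
    ring
  constructor
  · rw [EuclideanGeometry.mem_sphere, dist_eq_norm]
    have h1 : K.capPt i b - (K.S i).center =
        ((K.S i).radius - K.δ ^ 2 * ‖b‖ ^ 2 / (2 * (K.S i).radius)) • K.normal i +
          (K.δ * r) • b := by
      rw [sub_smul, radius_smul_normal, capPt]
      abel
    refine (sq_eq_sq₀ (norm_nonneg _) hR.le).1 ?_
    rw [h1, norm_sq_smul_normal_add K i hb', hn]
    field_simp
    ring
  · have h1 : K.capPt i b - K.x i =
        (-(K.δ ^ 2 * ‖b‖ ^ 2 / (2 * (K.S i).radius))) • K.normal i + (K.δ * r) • b := by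
      rw [neg_smul, capPt]
      abel
    refine (sq_le_sq₀ (norm_nonneg _) K.δ_pos.le).1 ?_
    rw [h1, norm_sq_smul_normal_add K i hb', hn]
    have h2 : ‖b‖ ^ 2 ≤ 1 := (sq_le_one_iff₀ (norm_nonneg b)).2 hb1
    have h3 : (-(K.δ ^ 2 * ‖b‖ ^ 2 / (2 * (K.S i).radius))) ^ 2 + K.δ ^ 2 * ‖b‖ ^ 2 *
        (1 - K.δ ^ 2 * ‖b‖ ^ 2 / (4 * (K.S i).radius ^ 2)) = K.δ ^ 2 * ‖b‖ ^ 2 := by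
      field_simp
      ring
    rw [h3]
    exact mul_le_of_le_one_right (sq_nonneg _) h2

theorem inner_normal_capPt (i : Fin n) {b : Ambient m} (hb : ⟪K.normal i, b⟫ = 0) :
    ⟪K.normal i, K.capPt i b - K.x i⟫ = -(K.δ ^ 2 * ‖b‖ ^ 2 / (2 * (K.S i).radius)) := by
  have h1 : K.capPt i b - K.x i =
      (-(K.δ ^ 2 * ‖b‖ ^ 2 / (2 * (K.S i).radius))) • K.normal i +
      (K.δ * √(1 - K.δ ^ 2 * ‖b‖ ^ 2 / (4 * (K.S i).radius ^ 2))) • b := by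
    rw [neg_smul, capPt]
    abel
  rw [h1, inner_add_right, inner_smul_right, inner_smul_right, hb, real_inner_self_eq_norm_sq,
    norm_normal]
  ring

/-- The normal component recovers ‖b‖; the tangential one then recovers b, since δ < 2R makes its
factor positive. -/
theorem capPt_inj (i : Fin n) {b b' : Ambient m} (hb : ⟪K.normal i, b⟫ = 0)
    (hb' : ⟪K.normal i, b'⟫ = 0) (hb1 : ‖b‖ ≤ 1) (h : K.capPt i b = K.capPt i b') : b = b' := by
  have hR := K.radius_pos i
  have hδ := K.δ_pos
  have h1 := K.inner_normal_capPt i hb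
  rw [h, K.inner_normal_capPt i hb', neg_inj, div_left_inj' (by positivity)] at h1
  have h2 : ‖b'‖ ^ 2 = ‖b‖ ^ 2 := mul_left_cancel₀ (by positivity) h1
  rw [capPt, capPt, h2] at h
  have h3 : 0 < K.δ * √(1 - K.δ ^ 2 * ‖b‖ ^ 2 / (4 * (K.S i).radius ^ 2)) :=
    mul_pos hδ (Real.sqrt_pos.2 (by linarith [K.cap_ratio_lt_one' i hb1]))
  exact smul_right_injective _ h3.ne' (add_left_cancel h)

theorem exists_capPt_eq (i : Fin n) {p : Ambient m} (hp : p ∈ K.cap i) :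
    ∃ b, ⟪K.normal i, b⟫ = 0 ∧ ‖b‖ ≤ 1 ∧ K.capPt i b = p := by
  have hR := K.radius_pos i
  have hδ := K.δ_pos
  obtain ⟨hp1, hp2⟩ := hp
  set q := p - K.x i with hq
  have hq2 : ‖q‖ ^ 2 ≤ K.δ ^ 2 := (sq_le_sq₀ (norm_nonneg _) hδ.le).2 hp2
  -- Expand ‖q + Rν‖² = R², the equation of the sphere seen from `x i`.
  have hin : ⟪K.normal i, q⟫ = -(‖q‖ ^ 2 / (2 * (K.S i).radius)) := by
    have h1 : q + (K.S i).radius • K.normal i = p - (K.S i).center := by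
      rw [radius_smul_normal, hq]
      abel
    have h2 : ‖q + (K.S i).radius • K.normal i‖ = (K.S i).radius := by
      rw [h1, ← dist_eq_norm]
      exact hp1
    have h3 := norm_add_sq_real q ((K.S i).radius • K.normal i)
    rw [h2, norm_smul, norm_normal, mul_one, Real.norm_eq_abs, sq_abs, inner_smul_right,
      real_inner_comm] at h3
    field_simp
    linarith
  have hlt := K.cap_ratio_lt_one i hq2
  set a := √(1 - ‖q‖ ^ 2 / (4 * (K.S i).radius ^ 2)) with ha
  have ha0 : 0 < a := Real.sqrt_pos.2 (by linarith)
  have ha2 : a ^ 2 = 1 - ‖q‖ ^ 2 / (4 * (K.S i).radius ^ 2) := Real.sq_sqrt (by linarith)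
  -- The tangential part of `q`; rescaled by 1/(δa) it is the required point of the ball.
  set τ := q + (‖q‖ ^ 2 / (2 * (K.S i).radius)) • K.normal i with hτ
  have hτ0 : ⟪K.normal i, τ⟫ = 0 := by
    rw [hτ, inner_add_right, inner_smul_right, real_inner_self_eq_norm_sq, norm_normal, hin]
    ring
  have hτn : ‖τ‖ ^ 2 = ‖q‖ ^ 2 * a ^ 2 := by
    have h1 : q = (-(‖q‖ ^ 2 / (2 * (K.S i).radius))) • K.normal i + τ := by
      rw [hτ]
      module
    have h2 := norm_sq_smul_normal_add K i hτ0 (-(‖q‖ ^ 2 / (2 * (K.S i).radius)))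
    rw [← h1] at h2
    have h3 : ‖τ‖ ^ 2 = ‖q‖ ^ 2 - (-(‖q‖ ^ 2 / (2 * (K.S i).radius))) ^ 2 := by linarith
    rw [h3, ha2]
    field_simp
    ring
  have hbn : K.δ ^ 2 * ‖(K.δ * a)⁻¹ • τ‖ ^ 2 = ‖q‖ ^ 2 := by
    rw [norm_smul, mul_pow, hτn, Real.norm_eq_abs, sq_abs]
    field_simp
  refine ⟨(K.δ * a)⁻¹ • τ, ?_, ?_, ?_⟩
  · rw [inner_smul_right, hτ0, mul_zero]
  · refine (sq_le_one_iff₀ (norm_nonneg _)).1 ?_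
    have : K.δ ^ 2 * ‖(K.δ * a)⁻¹ • τ‖ ^ 2 ≤ K.δ ^ 2 * 1 := by rw [hbn, mul_one]; exact hq2
    exact le_of_mul_le_mul_left this (by positivity)
  · rw [capPt, hbn, ← ha, smul_smul, mul_inv_cancel₀ (mul_pos hδ ha0).ne', one_smul, hτ, hq]
    abel

end HyperCaps

/-! ### Tangent frames, gluing maps and determinants -/

section Frames

variable {m : ℕ} [NeZero m]

/-- An isometric identification of the hyperplane orthogonal to `ν` with the model space, which
identifies `w` with the axis. -/
structure IsTangentFrame (ν w : Ambient m) (L : EuclideanSpace ℝ (Fin m) →ₗᵢ[ℝ] Ambient m) :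
    Prop where
  map_axis : L (axis m) = w
  mem_range : ∀ y, ⟪ν, y⟫ = 0 ↔ y ∈ Set.range L

theorem exists_isTangentFrame {ν w : Ambient m} (hν : ‖ν‖ = 1) (hw : ‖w‖ = 1) (h : ⟪ν, w⟫ = 0) :
    ∃ L, IsTangentFrame ν w L := by
  let V : Submodule ℝ (Ambient m) := (ℝ ∙ ν)ᗮ
  have hmem : ∀ y, y ∈ V ↔ ⟪ν, y⟫ = 0 := fun y => Submodule.mem_orthogonal_singleton_iff_inner_right
  have hfact : Fact (Module.finrank ℝ (Ambient m) = m + 1) := ⟨by simp⟩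
  have hν0 : ν ≠ 0 := norm_ne_zero_iff.1 (by rw [hν]; exact one_ne_zero)
  have hcard : Module.finrank ℝ V = Fintype.card (Fin m) := by
    rw [Fintype.card_fin]
    exact Submodule.finrank_orthogonal_span_singleton hν0
  let w' : V := ⟨w, (hmem w).2 h⟩
  have hon : Orthonormal ℝ (Set.domRestrict ({0} : Set (Fin m)) fun _ => w') := by
    constructor
    · intro i
      exact hw
    · intro i j hij
      exact (hij (Subsingleton.elim i j)).elim
  obtain ⟨b, hb⟩ := hon.exists_orthonormalBasis_extension_of_card_eq hcard
  refine ⟨V.subtypeₗᵢ.comp b.repr.symm.toLinearIsometry, ?_, ?_⟩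
  · change ((b.repr.symm (EuclideanSpace.single 0 1) : V) : Ambient m) = w
    rw [b.repr_symm_single, hb 0 rfl]
  · intro y
    rw [← hmem]
    constructor
    · intro hy
      exact ⟨b.repr ⟨y, hy⟩, congrArg Subtype.val (b.repr.symm_apply_apply _)⟩
    · rintro ⟨x, rfl⟩
      exact (b.repr.symm x).2

theorem IsTangentFrame.comp {ν w ν' w' : Ambient m} {L : EuclideanSpace ℝ (Fin m) →ₗᵢ[ℝ] Ambient m}
    (hL : IsTangentFrame ν w L) {T : Ambient m ≃ₗᵢ[ℝ] Ambient m} (hT : CarriesFrame T ν w ν' w') :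
    IsTangentFrame ν' w' (T.toLinearIsometry.comp L) := by
  refine ⟨?_, fun y => ?_⟩
  · change T (L _) = w'
    rw [hL.map_axis, hT.map_dir]
  · have h1 : ⟪ν', y⟫ = 0 ↔ ⟪ν, T.symm y⟫ = 0 := by
      rw [← T.inner_map_map ν, T.apply_symm_apply]
      rcases hT.map_normal with h | h
      · rw [h]
      · rw [h, inner_neg_left, neg_eq_zero]
    rw [h1, hL.mem_range]
    constructor
    · rintro ⟨x, hx⟩
      exact ⟨x, by change T (L x) = y; rw [hx, T.apply_symm_apply]⟩
    · rintro ⟨x, rfl⟩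
      exact ⟨x, (T.symm_apply_apply _).symm⟩

theorem IsTangentFrame.inner_eq {ν w : Ambient m} {L : EuclideanSpace ℝ (Fin m) →ₗᵢ[ℝ] Ambient m}
    (hL : IsTangentFrame ν w L) (x : EuclideanSpace ℝ (Fin m)) : ⟪w, L x⟫ = x 0 := by
  rw [← hL.map_axis, L.inner_map_map, inner_axis]

theorem IsTangentFrame.inner_normal {ν w : Ambient m}
    {L : EuclideanSpace ℝ (Fin m) →ₗᵢ[ℝ] Ambient m}
    (hL : IsTangentFrame ν w L) (x : EuclideanSpace ℝ (Fin m)) : ⟪ν, L x⟫ = 0 :=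
  (hL.mem_range _).2 ⟨x, rfl⟩

/-- In frames the gluing is just the reflection of the axis, so it carries the exit point of a
column to the entry point of a column. Here y = x along the chain, and y = A x at the closing strip.
-/
theorem glue_frame {w w' : Ambient m} {ν ν' : Ambient m}
    {L L' : EuclideanSpace ℝ (Fin m) →ₗᵢ[ℝ] Ambient m}
    (hL : IsTangentFrame ν w L) (hL' : IsTangentFrame ν' w' L') {T : Ambient m ≃ₗᵢ[ℝ] Ambient m}
    {x y : EuclideanSpace ℝ (Fin m)} (hT : T (L x) = L' y) (hxy : y 0 = x 0) :
    glue T w w' (L x) = L' (axisRefl y) := by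
  rw [glue, hT, hL.inner_eq, axisRefl, map_sub, map_smul, hL'.map_axis, hxy]

/-- Supplies the monodromy A: the frame carried once around the closed chain is compared with the
initial one. -/
theorem IsTangentFrame.exists_comp_eq {ν w : Ambient m}
    {L L' : EuclideanSpace ℝ (Fin m) →ₗᵢ[ℝ] Ambient m}
    (hL : IsTangentFrame ν w L) (hL' : IsTangentFrame ν w L') :
    ∃ A : EuclideanSpace ℝ (Fin m) ≃ₗᵢ[ℝ] EuclideanSpace ℝ (Fin m),
      A (axis m) = axis m ∧ ∀ x, L' x = L (A x) := by
  have hr : ∀ x, L' x ∈ LinearMap.range L.toLinearMap := fun x =>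
    (hL.mem_range _).1 (hL'.inner_normal x)
  let f : EuclideanSpace ℝ (Fin m) →ₗ[ℝ] EuclideanSpace ℝ (Fin m) :=
    L.equivRange.symm.toLinearEquiv.toLinearMap ∘ₗ L'.toLinearMap.codRestrict _ hr
  have hf : ∀ x, L (f x) = L' x := fun x =>
    congrArg Subtype.val (L.equivRange.apply_symm_apply ⟨L' x, hr x⟩)
  let g : EuclideanSpace ℝ (Fin m) →ₗᵢ[ℝ] EuclideanSpace ℝ (Fin m) :=
    ⟨f, fun x => by rw [← L.norm_map, hf, L'.norm_map]⟩
  refine ⟨g.toLinearIsometryEquiv rfl, L.injective ?_, fun x => (hf x).symm⟩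
  rw [hL.map_axis]
  exact (hf _).trans hL'.map_axis

/-- The ambient space is the direct sum of the range of `L` and the line of `ν`, and `Q` is
conjugate to A ⊕ id. -/
theorem IsTangentFrame.det_eq {ν w : Ambient m} (hν : ‖ν‖ = 1)
    {L : EuclideanSpace ℝ (Fin m) →ₗᵢ[ℝ] Ambient m} (hL : IsTangentFrame ν w L)
    {Q : Ambient m →ₗ[ℝ] Ambient m} (hQ : Q ν = ν)
    {A : EuclideanSpace ℝ (Fin m) →ₗ[ℝ] EuclideanSpace ℝ (Fin m)} (hA : ∀ x, Q (L x) = L (A x)) :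
    LinearMap.det A = LinearMap.det Q := by
  let f : EuclideanSpace ℝ (Fin m) × ℝ →ₗ[ℝ] Ambient m :=
    L.toLinearMap.coprod (LinearMap.toSpanSingleton ℝ _ ν)
  have hf : ∀ x s, f (x, s) = L x + s • ν := fun x s => rfl
  have hinj : Function.Injective f := by
    rw [← LinearMap.ker_eq_bot, LinearMap.ker_eq_bot']
    rintro ⟨x, s⟩ h
    rw [hf] at h
    have h1 : ⟪ν, L x + s • ν⟫ = 0 := by rw [h, inner_zero_right]
    rw [inner_add_right, hL.inner_normal, inner_smul_right, real_inner_self_eq_norm_sq, hν] at h1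
    have h2 : s = 0 := by linarith
    subst h2
    rw [zero_smul, add_zero] at h
    exact Prod.ext (L.injective (h.trans (map_zero L).symm)) rfl
  let e := f.linearEquivOfInjective hinj (by simp)
  have hconj : (e : EuclideanSpace ℝ (Fin m) × ℝ →ₗ[ℝ] Ambient m) ∘ₗ
      (A.prodMap LinearMap.id) ∘ₗ (e.symm : Ambient m →ₗ[ℝ] EuclideanSpace ℝ (Fin m) × ℝ) = Q := by
    ext1 y
    obtain ⟨⟨x, s⟩, rfl⟩ := e.surjective y
    change e (A.prodMap LinearMap.id (e.symm (e (x, s)))) = Q (e (x, s))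
    rw [e.symm_apply_apply]
    change f (A x, s) = Q (f (x, s))
    rw [hf, hf, map_add, map_smul, hQ, hA]
  rw [← hconj, LinearMap.det_conj, LinearMap.det_prodMap, LinearMap.det_id, mul_one]

end Frames

/-! ### Strips reparametrized over the hemisphere -/

section Strips

variable {K V X : Type*}

theorem image_columns_eq {f : V × ℝ → X} {R : Set V} {φ : K → V} (hR : R = Set.range φ)
    {κ : ℝ → ℝ} {S : Set ℝ} (hκ : ∀ t ∈ S, κ t = t) :
    (fun z : K × ℝ => f (φ z.1, κ z.2)) '' (Set.univ ×ˢ S) = f '' (R ×ˢ S) := by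
  subst hR
  ext p
  constructor
  · rintro ⟨⟨u, t⟩, ⟨-, ht⟩, rfl⟩
    exact ⟨(φ u, t), ⟨⟨u, rfl⟩, ht⟩, by simp only [hκ t ht]⟩
  · rintro ⟨⟨_, t⟩, ⟨⟨u, rfl⟩, ht⟩, rfl⟩
    exact ⟨(u, t), ⟨trivial, ht⟩, by simp only [hκ t ht]⟩

theorem injOn_columns {f : V × ℝ → X} {R : Set V} {φ : K → V} (hφ : Function.Injective φ)
    (hR : R = Set.range φ) {κ : ℝ → ℝ} {S : Set ℝ} (hκ : ∀ t ∈ S, κ t = t)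
    (hi : Set.InjOn f (R ×ˢ S)) :
    Set.InjOn (fun z : K × ℝ => f (φ z.1, κ z.2)) (Set.univ ×ˢ S) := by
  subst hR
  rintro ⟨u, t⟩ ⟨-, ht⟩ ⟨v, t'⟩ ⟨-, ht'⟩ h
  simp only [hκ t ht, hκ t' ht'] at h
  have := hi (x₁ := (φ u, t)) (x₂ := (φ v, t')) ⟨⟨u, rfl⟩, ht⟩ ⟨⟨v, rfl⟩, ht'⟩ h
  rw [Prod.mk.injEq] at this
  exact Prod.ext (hφ this.1) this.2

theorem continuous_columns [TopologicalSpace K] [TopologicalSpace V] [TopologicalSpace X]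
    {f : V × ℝ → X} {R : Set V} {φ : K → V} (hφ : Continuous φ)
    (hR : R = Set.range φ) {κ : ℝ → ℝ} (hκ : Continuous κ) {J : Set ℝ} (hJ : ∀ t, κ t ∈ J)
    (hf : ContinuousOn f (R ×ˢ J)) : Continuous fun z : K × ℝ => f (φ z.1, κ z.2) := by
  subst hR
  exact hf.comp_continuous ((hφ.comp continuous_fst).prodMk (hκ.comp continuous_snd))
    fun z => ⟨⟨z.1, rfl⟩, hJ z.2⟩

end Strips

theorem IsStripToInfinity.exists_norm_gt {m n : ℕ} {K : HyperCaps m n} {i : Fin n}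
    {w : Ambient m} {c : ℝ} {e : Ambient m} {f : Ambient m × ℝ → Ambient m} (hf : IsStripToInfinity K i w c e f)
    (r : ℝ) : ∃ T : ℝ, ∀ u ∈ K.rimPart i w c, ∀ t, T ≤ t → r < ‖f (u, t)‖ := by
  obtain ⟨s, hs, s', hs', h⟩ := Filter.mem_prod_iff.1 (hf.tendsto_norm.eventually_gt_atTop r)
  obtain ⟨T, hT⟩ := Filter.mem_atTop_sets.1 hs'
  exact ⟨T, fun u hu t ht => h (Set.mk_mem_prod (Filter.mem_principal.1 hs hu) (hT t ht))⟩

/-! ### Assembling the hypersurfaces -/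

section Blocks

variable {m : ℕ} [NeZero m]

theorem HyperCaps.rimPart_eq_range {n : ℕ} (K : HyperCaps m n) {i : Fin n} {w : Ambient m}
    {L : EuclideanSpace ℝ (Fin m) →ₗᵢ[ℝ] Ambient m} (hL : IsTangentFrame (K.normal i) w L) {c : ℝ}
    (hc : 0 ≤ c) (hc1 : c < 1) :
    K.rimPart i w c = Set.range fun u : Hemi m => L (roundPt c u.1) := by
  ext y
  constructor
  · rintro ⟨h1, h2, h3⟩
    obtain ⟨x, rfl⟩ := (hL.mem_range y).1 h2
    rw [L.norm_map] at h1
    rw [hL.inner_eq] at h3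
    obtain ⟨u, rfl⟩ := exists_roundPt_eq hc hc1 h1 h3
    exact ⟨u, rfl⟩
  · rintro ⟨u, rfl⟩
    refine ⟨?_, hL.inner_normal _, ?_⟩
    · rw [L.norm_map, norm_roundPt hc hc1]
    · rw [hL.inner_eq, roundPt_apply_zero]
      exact le_roundHeight hc hc1 _

theorem HyperCaps.rimPart_neg_eq_range {n : ℕ} (K : HyperCaps m n) {i : Fin n} {w : Ambient m}
    {L : EuclideanSpace ℝ (Fin m) →ₗᵢ[ℝ] Ambient m} (hL : IsTangentFrame (K.normal i) w L) {c : ℝ}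
    (hc : 0 ≤ c) (hc1 : c < 1) :
    K.rimPart i (-w) c = Set.range fun u : Hemi m => L (axisRefl (roundPt c u.1)) := by
  ext y
  constructor
  · rintro ⟨h1, h2, h3⟩
    obtain ⟨x, rfl⟩ := (hL.mem_range y).1 h2
    rw [L.norm_map, ← norm_axisRefl] at h1
    rw [inner_neg_left, hL.inner_eq, ← axisRefl_apply_zero] at h3
    obtain ⟨u, hu⟩ := exists_roundPt_eq hc hc1 h1 h3
    exact ⟨u, by simp only [hu, axisRefl_axisRefl]⟩
  · rintro ⟨u, rfl⟩
    refine ⟨?_, hL.inner_normal _, ?_⟩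
    · rw [L.norm_map, norm_axisRefl, norm_roundPt hc hc1]
    · rw [inner_neg_left, hL.inner_eq, axisRefl_apply_zero, neg_neg, roundPt_apply_zero]
      exact le_roundHeight hc hc1 _

/-- A cap, followed by a connecting piece. -/
theorem HyperCaps.exists_cap_columns {n : ℕ} (K : HyperCaps m n) {i : Fin n} {w : Ambient m}
    {L : EuclideanSpace ℝ (Fin m) →ₗᵢ[ℝ] Ambient m} (hL : IsTangentFrame (K.normal i) w L) {c d : ℝ}
    (hc : 0 ≤ c) (hc1 : c < 1) (hd : 0 ≤ d) (hd1 : d < 1) {g : Hemi m × ℝ → Ambient m}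
    (hg : Continuous g) (hg0 : ∀ u : Hemi m, g (u, 0) = K.rimPt i (L (roundPt d u.1)))
    (hgi : Set.InjOn g (Set.univ ×ˢ Set.Ioo 0 1))
    (hdisj : Disjoint (K.cap i) (g '' (Set.univ ×ˢ Set.Ioo 0 1))) :
    ∃ B : Hemi m × ℝ → Ambient m, Continuous B ∧
      (∀ u : Hemi m, B (u, 0) = K.rimPt i (L (axisRefl (roundPt c u.1)))) ∧
      (∀ u, B (u, 1) = g (u, 1)) ∧ Set.InjOn B (HalfOpenColumns (Hemi m)) ∧
      B '' HalfOpenColumns (Hemi m) = K.cap i ∪ g '' (Set.univ ×ˢ Set.Ioo 0 1) := by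
  -- The ball column of u runs from height `-roundHeight c u` to `roundHeight d u`; `P` shifts its
  -- parameter to start at 0, and `a` is its length.
  let a : Hemi m → ℝ := fun u => roundHeight c u.1 + roundHeight d u.1
  let P : Hemi m × ℝ → Ambient m := fun z =>
    K.capPt i (L (ballColumn c d z.1.1 (z.2 - roundHeight c z.1.1)))
  have hrange : ∀ z ∈ {z : Hemi m × ℝ | z.2 ∈ Set.Icc 0 (a z.1)},
      ‖L (ballColumn c d z.1.1 (z.2 - roundHeight c z.1.1))‖ ≤ 1 := by
    rintro ⟨u, t⟩ ⟨h1, h2⟩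
    simp only [a] at h1 h2
    rw [L.norm_map]
    exact norm_ballColumn_le hc hc1 hd hd1 u (by linarith) (by linarith)
  have himage : P '' {z | z.2 ∈ Set.Icc 0 (a z.1)} = K.cap i := by
    ext p
    constructor
    · rintro ⟨z, hz, rfl⟩
      exact K.capPt_mem_cap i (hL.inner_normal _) (hrange z hz)
    · intro hp
      obtain ⟨b, hb, hb1, rfl⟩ := K.exists_capPt_eq i hp
      obtain ⟨x, rfl⟩ := (hL.mem_range b).1 hb
      rw [L.norm_map] at hb1
      obtain ⟨u, h1, h2, h3⟩ := exists_ballColumn_eq hc hc1 hd hd1 hb1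
      refine ⟨(u, x 0 + roundHeight c u.1), ⟨?_, ?_⟩, ?_⟩
      · simp only
        linarith
      · simp only [a]
        linarith
      · simp only [P, add_sub_cancel_right, h3]
  have hcont : Continuous fun u : Hemi m => roundHeight c u.1 :=
    (continuous_roundHeight c).comp continuous_subtype_val
  obtain ⟨B, hB, hB0, hB1, hBi, hBr⟩ := exists_join_columns (a := a) (P := P) (g := g)
    (hcont.add ((continuous_roundHeight d).comp continuous_subtype_val))
    (fun u => add_nonneg (Real.sqrt_nonneg _) (Real.sqrt_nonneg _))
    ((K.continuous_capPt i).comp (L.continuous.comp ((continuous_ballColumn c d).comp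
      ((continuous_subtype_val.comp continuous_fst).prodMk
        (continuous_snd.sub (hcont.comp continuous_fst))))))
    hg (fun u => by
      rw [hg0]
      simp only [P, a, add_sub_cancel_left]
      rw [ballColumn_top hc hd hd1,
        K.capPt_eq_rimPt i (by rw [L.norm_map, norm_roundPt hd hd1])])
    (fun z hz z' hz' h => by
      have h1 := K.capPt_inj i (hL.inner_normal _) (hL.inner_normal _) (hrange z hz) h
      have h2 := ballColumn_injective hc hc1 hd1
        (a₁ := (z.1, z.2 - roundHeight c z.1.1)) (a₂ := (z'.1, z'.2 - roundHeight c z'.1.1))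
        (L.injective h1)
      rw [Prod.mk.injEq] at h2
      obtain ⟨h3, h4⟩ := h2
      rw [h3] at h4
      exact Prod.ext h3 (sub_left_injective h4))
    hgi (by rwa [himage])
  refine ⟨B, hB, fun u => ?_, hB1, hBi, by rw [hBr, himage]⟩
  rw [hB0]
  simp only [P, zero_sub]
  rw [ballColumn_bot hc hc1 hd,
    K.capPt_eq_rimPt i (by rw [L.norm_map, norm_axisRefl, norm_roundPt hc hc1])]

variable {N : ℕ} {K : HyperCaps m (N + 1)}

/-- The chain of all caps and cylinders, followed by a connecting piece. -/
theorem CapChain.exists_columns (C : CapChain K) (hC : C.Embedded)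
    {L : Fin (N + 1) → EuclideanSpace ℝ (Fin m) →ₗᵢ[ℝ] Ambient m}
    (hL : ∀ k, IsTangentFrame (K.normal (C.ord k)) (C.dir k) (L k))
    (hLs : ∀ (k : Fin N) x, C.rot k (L k.castSucc x) = L k.succ x) {c₀ c₁ : ℝ}
    (hc₀ : 0 ≤ c₀) (hc₀' : c₀ < 1) (hc₁ : 0 ≤ c₁) (hc₁' : c₁ < 1) {g : Hemi m × ℝ → Ambient m}
    (hg : Continuous g)
    (hg0 : ∀ u : Hemi m, g (u, 0) = K.rimPt (C.ord (Fin.last N)) (L (Fin.last N) (roundPt c₁ u.1)))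
    (hgi : Set.InjOn g (Set.univ ×ˢ Set.Ioo 0 1))
    (hdisj : Disjoint C.body (g '' (Set.univ ×ˢ Set.Ioo 0 1))) :
    ∃ B : Hemi m × ℝ → Ambient m, Continuous B ∧
      (∀ u : Hemi m, B (u, 0) = K.rimPt (C.ord 0) (L 0 (axisRefl (roundPt c₀ u.1)))) ∧
      (∀ u, B (u, 1) = g (u, 1)) ∧ Set.InjOn B (HalfOpenColumns (Hemi m)) ∧
      B '' HalfOpenColumns (Hemi m) = C.body ∪ g '' (Set.univ ×ˢ Set.Ioo 0 1) := by
  let cyl : Fin N → Hemi m × ℝ → Ambient m := fun k z => C.cylPt k (L k.castSucc z.1.1) z.2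
  let G : Fin (N + 1) → Hemi m × ℝ → Ambient m := Fin.lastCases g cyl
  have hGl : G (Fin.last N) = g := Fin.lastCases_last
  have hGc : ∀ k : Fin N, G k.castSucc = cyl k := fun k => Fin.lastCases_castSucc k
  -- Cylinders use full halves of the rims, which correspond to 0, where `roundPt` is the identity
  -- on the hemisphere. Only the entry of the first cap and the exit of the last one have other
  -- parameters.
  let c : Fin (N + 1) → ℝ := Fin.cases c₀ fun _ => 0
  let d : Fin (N + 1) → ℝ := Fin.lastCases c₁ fun _ => 0
  have hcs : ∀ k : Fin N, c k.succ = 0 := fun k => rfl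
  have hdl : d (Fin.last N) = c₁ := Fin.lastCases_last
  have hdc : ∀ k : Fin N, d k.castSucc = 0 := fun k => Fin.lastCases_castSucc k
  have hhalf : ∀ k : Fin N, C.half k = Set.range fun u : Hemi m => L k.castSucc u.1 := by
    intro k
    rw [half, K.rimPart_eq_range (hL k.castSucc) le_rfl one_pos]
    simp only [roundPt_zero]
  have hcyl : ∀ k, cyl k '' (Set.univ ×ˢ Set.Ioo 0 1) = C.cyl k := fun k =>
    image_columns_eq (f := fun q : Ambient m × ℝ => C.cylPt k q.1 q.2) (κ := id) (hhalf k)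
      fun _ _ => rfl
  have hcapE : ∀ i k, Disjoint (K.cap i) (G k '' (Set.univ ×ˢ Set.Ioo 0 1)) := by
    intro i k
    induction k using Fin.lastCases with
    | last =>
      rw [hGl]
      exact hdisj.mono_left (Set.subset_union_of_subset_left (Set.subset_iUnion K.cap i) _)
    | cast k =>
      rw [hGc, hcyl]
      exact hC.cap_cyl_disjoint i k
  have hcylg : ∀ k, Disjoint (C.cyl k) (g '' (Set.univ ×ˢ Set.Ioo 0 1)) := fun k =>
    hdisj.mono_left (Set.subset_union_of_subset_right (Set.subset_iUnion C.cyl k) _)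
  have hEE : ∀ k l, k ≠ l → Disjoint (G k '' (Set.univ ×ˢ Set.Ioo 0 1))
      (G l '' (Set.univ ×ˢ Set.Ioo 0 1)) := by
    intro k l hkl
    induction k using Fin.lastCases with
    | last =>
      induction l using Fin.lastCases with
      | last => exact (hkl rfl).elim
      | cast l =>
        rw [hGl, hGc, hcyl]
        exact (hcylg l).symm
    | cast k =>
      induction l using Fin.lastCases with
      | last =>
        rw [hGl, hGc, hcyl]
        exact hcylg k
      | cast l =>
        rw [hGc, hGc, hcyl, hcyl]
        exact hC.cyl_disjoint k l fun h => hkl (congrArg _ h)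
  have hblock : ∀ k, ∃ B : Hemi m × ℝ → Ambient m, Continuous B ∧
      (∀ u : Hemi m, B (u, 0) = K.rimPt (C.ord k) (L k (axisRefl (roundPt (c k) u.1)))) ∧
      (∀ u, B (u, 1) = G k (u, 1)) ∧ Set.InjOn B (HalfOpenColumns (Hemi m)) ∧
      B '' HalfOpenColumns (Hemi m) =
        K.cap (C.ord k) ∪ G k '' (Set.univ ×ˢ Set.Ioo 0 1) := by
    intro k
    have hck : 0 ≤ c k ∧ c k < 1 := by
      induction k using Fin.cases with
      | zero => exact ⟨hc₀, hc₀'⟩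
      | succ k => exact ⟨le_rfl, one_pos⟩
    have hdk : 0 ≤ d k ∧ d k < 1 := by
      induction k using Fin.lastCases with
      | last => rw [hdl]; exact ⟨hc₁, hc₁'⟩
      | cast k => rw [hdc]; exact ⟨le_rfl, one_pos⟩
    refine K.exists_cap_columns (hL k) hck.1 hck.2 hdk.1 hdk.2 ?_ ?_ ?_ (hcapE _ _)
    · induction k using Fin.lastCases with
      | last => rwa [hGl]
      | cast k =>
        rw [hGc]
        simp only [cyl, cylPt, HyperCaps.rimPt, glue]
        have := (L k.castSucc).continuous
        have := (C.rot k).continuous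
        fun_prop
    · induction k using Fin.lastCases with
      | last => rwa [hGl, hdl]
      | cast k =>
        intro u
        rw [hGc, hdc, roundPt_zero]
        simp only [cyl, cylPt, sub_zero, one_smul, zero_smul, add_zero]
    · induction k using Fin.lastCases with
      | last => rwa [hGl]
      | cast k =>
        rw [hGc]
        exact injOn_columns (f := fun q : Ambient m × ℝ => C.cylPt k q.1 q.2) (κ := id)
          ((L k.castSucc).injective.comp Subtype.val_injective) (hhalf k) (fun _ _ => rfl)
          ((hC.cyl_injOn k).mono (Set.prod_mono_right Set.Ioo_subset_Icc_self))
  choose b hb hb0 hb1 hbi hbr using hblock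
  obtain ⟨B, hB, hB0, hB1, hBi, hBr⟩ := exists_concat_columns hb (fun k u => by
      rw [hb1, hb0, hGc, hcs, roundPt_zero]
      simp only [cyl, cylPt, sub_self, zero_smul, zero_add, one_smul]
      rw [glue_frame (hL k.castSucc) (hL k.succ) (hLs k u.1) rfl]) hbi
    (fun k l hkl => by
      rw [hbr, hbr, Set.disjoint_union_left, Set.disjoint_union_right, Set.disjoint_union_right]
      exact ⟨⟨hC.cap_disjoint _ _ fun h => hkl (C.ord.injective h), hcapE _ _⟩,
        (hcapE _ _).symm, hEE k l hkl⟩)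
  refine ⟨B, hB, fun u => ?_, fun u => ?_, hBi, ?_⟩
  · rw [hB0, hb0]
    rfl
  · rw [hB1, hb1, hGl]
  · rw [hBr]
    simp only [hbr]
    rw [Set.iUnion_union_distrib, body, Set.union_assoc]
    congr 1
    · exact C.ord.surjective.iUnion_comp K.cap
    · ext p
      simp only [Set.mem_union, Set.mem_iUnion]
      rw [Fin.exists_fin_succ' (P := fun i => p ∈ G i '' (Set.univ ×ˢ Set.Ioo 0 1)), hGl]
      simp only [hGc, hcyl]

/-- Consecutive tangent frames of the caps of the chain, carried along by the rotations. -/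
theorem CapChain.exists_frames (C : CapChain K) :
    ∃ (P : Fin (N + 1) → Ambient m ≃ₗᵢ[ℝ] Ambient m)
      (L : EuclideanSpace ℝ (Fin m) →ₗᵢ[ℝ] Ambient m),
      (∀ x, P 0 x = x) ∧ (∀ (k : Fin N) x, P k.succ x = C.rot k (P k.castSucc x)) ∧
      ∀ k, IsTangentFrame (K.normal (C.ord k)) (C.dir k) ((P k).toLinearIsometry.comp L) := by
  obtain ⟨L, hL⟩ := exists_isTangentFrame (K.norm_normal (C.ord 0)) (C.norm_dir 0)
    (C.dir_tangent 0)
  let P : Fin (N + 1) → Ambient m ≃ₗᵢ[ℝ] Ambient m := fun k =>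
    Fin.induction (motive := fun _ => Ambient m ≃ₗᵢ[ℝ] Ambient m) (LinearIsometryEquiv.refl ℝ _)
      (fun k p => p.trans (C.rot k)) k
  have hP : ∀ (k : Fin N) x, P k.succ x = C.rot k (P k.castSucc x) := fun k x => rfl
  refine ⟨P, L, fun x => rfl, hP, fun k => ?_⟩
  induction k using Fin.induction with
  | zero => exact hL
  | succ k ih => exact ih.comp (C.rot_carries k)

/-- The hypersurface is the mapping torus of the monodromy A acting on the hemisphere, and
untwistedness gives det A = 1. -/
theorem ClosingStrip.isOrientable_hypersurface {C : CapChain K} (hC : C.Embedded)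
    (s : ClosingStrip C) (hs : s.Untwisted) : IsOrientable m s.hypersurface := by
  obtain ⟨P, L₀, hP0, hPs, hL⟩ := C.exists_frames
  set L : Fin (N + 1) → EuclideanSpace ℝ (Fin m) →ₗᵢ[ℝ] Ambient m :=
    fun k => (P k).toLinearIsometry.comp L₀
  have hL0 : ∀ x, L 0 x = L₀ x := fun x => hP0 _
  obtain ⟨A, hA, hAL⟩ := (hL 0).exists_comp_eq ((hL (Fin.last N)).comp s.rot_carries)
  have hAL' : ∀ x, s.rot (L (Fin.last N) x) = L 0 (A x) := hAL
  have hdet : LinearMap.det (A.toLinearEquiv :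
      EuclideanSpace ℝ (Fin m) →ₗ[ℝ] EuclideanSpace ℝ (Fin m)) = 1 := by
    obtain ⟨side, hside, hrot, hlast⟩ := hs
    -- The transported frame keeps to the chosen sides, so going once around fixes `side 0`, hence
    -- also the normal, which is ± that side.
    have hPside : ∀ k, P k (side 0) = side k := by
      intro k
      induction k using Fin.induction with
      | zero => exact hP0 _
      | succ k ih => rw [hPs, ih, hrot]
    have hPdet : ∀ k, LinearMap.det ((P k).toLinearEquiv : Ambient m →ₗ[ℝ] Ambient m) = 1 := by
      intro k
      induction k using Fin.induction with
      | zero =>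
        have : ((P 0).toLinearEquiv : Ambient m →ₗ[ℝ] Ambient m) = LinearMap.id :=
          LinearMap.ext hP0
        rw [this, LinearMap.det_id]
      | succ k ih =>
        have : ((P k.succ).toLinearEquiv : Ambient m →ₗ[ℝ] Ambient m) =
            ((C.rot k).toLinearEquiv : Ambient m →ₗ[ℝ] Ambient m) ∘ₗ
              ((P k.castSucc).toLinearEquiv : Ambient m →ₗ[ℝ] Ambient m) :=
          LinearMap.ext (hPs k)
        rw [this, LinearMap.det_comp, ih, (C.rot_carries k).det_eq, one_mul]
    have hQside : s.rot (P (Fin.last N) (side 0)) = side 0 := by rw [hPside, hlast]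
    have hQ : s.rot (P (Fin.last N) (K.normal (C.ord 0))) = K.normal (C.ord 0) := by
      rcases hside 0 with h | h
      · rwa [h] at hQside
      · rw [h, map_neg, map_neg] at hQside
        exact neg_injective hQside
    have hfin := (hL 0).det_eq (K.norm_normal _)
      (Q := (s.rot.toLinearEquiv : Ambient m →ₗ[ℝ] Ambient m) ∘ₗ
        ((P (Fin.last N)).toLinearEquiv : Ambient m →ₗ[ℝ] Ambient m)) hQ
      (A := (A.toLinearEquiv : EuclideanSpace ℝ (Fin m) →ₗ[ℝ] EuclideanSpace ℝ (Fin m)))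
      (fun x => by
        change s.rot (P (Fin.last N) (L 0 x)) = L 0 (A x)
        rw [hL0, ← hAL']
        rfl)
    rw [hfin, LinearMap.det_comp, s.rot_carries.det_eq, hPdet, one_mul]
  -- The strip map is continuous only on times in [0, 1]; clamping the time makes it continuous on
  -- all of `Hemi m × ℝ`.
  let κ : ℝ → ℝ := fun t => max 0 (min t 1)
  have hκ : Continuous κ := by fun_prop
  have hκI : ∀ t, κ t ∈ Set.Icc (0 : ℝ) 1 := fun t =>
    ⟨le_max_left _ _, max_le zero_le_one (min_le_right _ _)⟩
  have hκe : ∀ t ∈ Set.Icc (0 : ℝ) 1, κ t = t := by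
    rintro t ⟨h0, h1⟩
    simp only [κ, min_eq_left h1, max_eq_right h0]
  have hR := K.rimPart_eq_range (hL (Fin.last N)) s.c_nonneg s.c_lt_one
  have hmem : ∀ u : Hemi m, L (Fin.last N) (roundPt s.c u.1) ∈
      K.rimPart (C.ord (Fin.last N)) (C.dir (Fin.last N)) s.c := fun u => by
    rw [hR]; exact ⟨u, rfl⟩
  have himg := image_columns_eq (f := s.map) hR (κ := κ) (S := Set.Ioo 0 1)
    fun t ht => hκe t (Set.Ioo_subset_Icc_self ht)
  obtain ⟨B, hB, hB0, hB1, hBi, hBr⟩ := C.exists_columns hC hL (fun k x => (hPs k _).symm)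
    s.c_nonneg s.c_lt_one s.c_nonneg s.c_lt_one
    (g := fun z => s.map (L (Fin.last N) (roundPt s.c z.1.1), κ z.2))
    (continuous_columns ((L (Fin.last N)).continuous.comp ((continuous_roundPt _).comp
      continuous_subtype_val)) hR hκ hκI s.continuousOn)
    (fun u => by
      simp only [hκe 0 ⟨le_rfl, zero_le_one⟩]
      exact s.map_zero _ (hmem u))
    (injOn_columns ((L (Fin.last N)).injective.comp (roundPt_injective s.c_nonneg s.c_lt_one)) hR
      (fun t ht => hκe t (Set.Ioo_subset_Icc_self ht))
      (s.injOn.mono (Set.prod_mono_right Set.Ioo_subset_Icc_self)))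
    (by rw [himg]; exact s.disjoint_body)
  have hset : s.hypersurface = B '' HalfOpenColumns (Hemi m) := by
    rw [hBr, himg]
    rfl
  rw [hset]
  obtain ⟨Φ, hΦ, hsurj, hfib⟩ := exists_periodic_columns hB (hemiMap A hA) (fun u => by
    rw [hB1, hB0]
    simp only [hκe 1 ⟨zero_le_one, le_rfl⟩]
    rw [s.map_one _ (hmem u), glue_frame (hL (Fin.last N)) (hL 0) (hAL' _)
      (apply_zero_of_fixes_axis hA _), ← roundPt_map hA]
    rfl) hBi
  -- The fibres satisfy z.1 = Aᵏ z'.1, so raising the height by k acts on the hemisphere by A⁻ᵏ.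
  refine isOrientable_of_polar_cover hΦ hsurj A⁻¹ ?_ one_pos fun z z' h => ?_
  · rw [← zpow_neg_one]
    exact det_zpow_pos A (by rw [hdet]; exact one_pos) (-1)
  · obtain ⟨k, hk, hk'⟩ := hfib z z' h
    refine ⟨k, by rw [hk, mul_one], ?_⟩
    rw [hk', coe_hemiMap_zpow, inv_zpow]
    exact ((A ^ k).symm_apply_apply _).symm

/-- The hypersurface is homeomorphic to `Hemi m × ℝ`. There is no monodromy, so no condition on
twisting is needed. -/
theorem InfiniteStrips.isOrientable_hypersurface {C : CapChain K} (hC : C.Embedded)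
    (s : InfiniteStrips C) : IsOrientable m s.hypersurface := by
  obtain ⟨P, L₀, hP0, hPs, hL⟩ := C.exists_frames
  set L : Fin (N + 1) → EuclideanSpace ℝ (Fin m) →ₗᵢ[ℝ] Ambient m :=
    fun k => (P k).toLinearIsometry.comp L₀
  let κ : ℝ → ℝ := fun t => max 0 t
  have hκ : Continuous κ := by fun_prop
  have hκI : ∀ t, κ t ∈ Set.Ici (0 : ℝ) := fun t => Set.mem_Ici.2 (le_max_left 0 t)
  have hκe : ∀ t ∈ Set.Ici (0 : ℝ), κ t = t := fun t ht => max_eq_right ht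
  have hR₀ := K.rimPart_neg_eq_range (hL 0) s.c₀_nonneg s.c₀_lt_one
  have hR₁ := K.rimPart_eq_range (hL (Fin.last N)) s.c₁_nonneg s.c₁_lt_one
  have hmem₀ : ∀ u : Hemi m, L 0 (axisRefl (roundPt s.c₀ u.1)) ∈
      K.rimPart (C.ord 0) (-C.dir 0) s.c₀ := fun u => by rw [hR₀]; exact ⟨u, rfl⟩
  have hmem₁ : ∀ u : Hemi m, L (Fin.last N) (roundPt s.c₁ u.1) ∈
      K.rimPart (C.ord (Fin.last N)) (C.dir (Fin.last N)) s.c₁ := fun u => by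
    rw [hR₁]; exact ⟨u, rfl⟩
  set g₀ : Hemi m × ℝ → Ambient m :=
    fun z => s.map₀ (L 0 (axisRefl (roundPt s.c₀ z.1.1)), κ z.2) with hg₀
  set g₁ : Hemi m × ℝ → Ambient m :=
    fun z => s.map₁ (L (Fin.last N) (roundPt s.c₁ z.1.1), κ z.2) with hg₁
  have hφ₀ : Function.Injective fun u : Hemi m => L 0 (axisRefl (roundPt s.c₀ u.1)) :=
    (L 0).injective.comp ((Function.LeftInverse.injective axisRefl_axisRefl).comp
      (roundPt_injective s.c₀_nonneg s.c₀_lt_one))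
  have hg₀c : Continuous g₀ := continuous_columns (φ := fun u : Hemi m =>
    L 0 (axisRefl (roundPt s.c₀ u.1))) ((L 0).continuous.comp (continuous_axisRefl.comp
      ((continuous_roundPt _).comp continuous_subtype_val))) hR₀ hκ hκI s.isStrip₀.continuousOn
  have hg₁c : Continuous g₁ := continuous_columns (φ := fun u : Hemi m =>
    L (Fin.last N) (roundPt s.c₁ u.1)) ((L (Fin.last N)).continuous.comp
      ((continuous_roundPt _).comp continuous_subtype_val)) hR₁ hκ hκI s.isStrip₁.continuousOn
  have hg₀i : Set.InjOn g₀ (Set.univ ×ˢ Set.Ici 0) := injOn_columns hφ₀ hR₀ hκe s.isStrip₀.injOn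
  have hg₁i : Set.InjOn g₁ (Set.univ ×ˢ Set.Ici 0) := injOn_columns
    ((L (Fin.last N)).injective.comp (roundPt_injective s.c₁_nonneg s.c₁_lt_one)) hR₁ hκe
    s.isStrip₁.injOn
  have himg₀ : g₀ '' (Set.univ ×ˢ Set.Ioi 0) = s.strip₀ :=
    image_columns_eq hR₀ fun t ht => hκe t (Set.Ioi_subset_Ici_self ht)
  have himg₁ : g₁ '' (Set.univ ×ˢ Set.Ioi 0) = s.strip₁ :=
    image_columns_eq hR₁ fun t ht => hκe t (Set.Ioi_subset_Ici_self ht)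
  have hsub : g₁ '' (Set.univ ×ˢ Set.Ioo 0 1) ⊆ s.strip₁ := by
    rw [← himg₁]
    exact Set.image_mono (Set.prod_mono_right Set.Ioo_subset_Ioi_self)
  obtain ⟨B, hB, hB0, hB1, hBi, hBr⟩ := C.exists_columns hC hL (fun k x => (hPs k _).symm)
    s.c₀_nonneg s.c₀_lt_one s.c₁_nonneg s.c₁_lt_one hg₁c
    (fun u => by
      simp only [hg₁, hκe 0 Set.self_mem_Ici]
      exact s.isStrip₁.map_zero _ (hmem₁ u))
    (hg₁i.mono (Set.prod_mono_right (Set.Ioo_subset_Icc_self.trans Set.Icc_subset_Ici_self)))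
    (s.disjoint_body₁.mono_right hsub)
  -- The last strip is cut at time 1: its first unit is the connecting piece after the last cap in
  -- `B`, and the rest is `S₁`.
  set S₁ : Hemi m × ℝ → Ambient m := fun z => g₁ (z.1, z.2 + 1) with hS₁
  have hS₁img : S₁ '' (Set.univ ×ˢ Set.Ici 0) = g₁ '' (Set.univ ×ˢ Set.Ici 1) := by
    ext p
    constructor
    · rintro ⟨⟨u, t⟩, ⟨-, ht⟩, rfl⟩
      exact ⟨(u, t + 1), ⟨trivial, Set.mem_Ici.2 (le_add_of_nonneg_left (Set.mem_Ici.1 ht))⟩, rfl⟩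
    · rintro ⟨⟨u, t⟩, ⟨-, ht⟩, rfl⟩
      exact ⟨(u, t - 1), ⟨trivial, Set.mem_Ici.2 (sub_nonneg.2 (Set.mem_Ici.1 ht))⟩, by
        simp only [hS₁, sub_add_cancel]⟩
  have hS₁sub : S₁ '' (Set.univ ×ˢ Set.Ici 0) ⊆ s.strip₁ := by
    rw [hS₁img, ← himg₁]
    exact Set.image_mono (Set.prod_mono_right (Set.Ici_subset_Ioi.2 one_pos))
  obtain ⟨Φ, hΦ, hΦi, hΦr, hΦ0, hΦ1⟩ := exists_line_columns (S₁ := S₁) hB hg₀c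
    (hg₁c.comp (by fun_prop))
    (fun u => by
      rw [hB0]
      simp only [hg₀, hκe 0 Set.self_mem_Ici]
      exact s.isStrip₀.map_zero _ (hmem₀ u))
    (fun u => by rw [hB1]; simp only [hS₁, zero_add]) hBi
    (hg₀i.mono (Set.prod_mono_right Set.Ioi_subset_Ici_self))
    (by
      rintro ⟨u, t⟩ ⟨-, ht⟩ ⟨u', t'⟩ ⟨-, ht'⟩ h
      have h1 : 0 ≤ t := ht
      have h2 : 0 ≤ t' := ht'
      have := hg₁i (x₁ := (u, t + 1)) (x₂ := (u', t' + 1))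
        ⟨trivial, Set.mem_Ici.2 (by linarith)⟩ ⟨trivial, Set.mem_Ici.2 (by linarith)⟩ h
      rw [Prod.mk.injEq] at this
      exact Prod.ext this.1 (add_left_injective _ this.2))
    (by
      rw [hBr, himg₀, Set.disjoint_union_left]
      exact ⟨s.disjoint_body₀, (s.disjoint_strips.mono_right hsub).symm⟩)
    (by
      rw [hBr, Set.disjoint_union_left]
      refine ⟨s.disjoint_body₁.mono_right hS₁sub, ?_⟩
      rw [hS₁img, Set.disjoint_left]
      rintro _ ⟨⟨u, t⟩, ⟨-, ht⟩, rfl⟩ ⟨⟨u', t'⟩, ⟨-, ht'⟩, h⟩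
      have h1 := hg₁i (x₁ := (u', t')) (x₂ := (u, t))
        ⟨trivial, zero_le_one.trans (Set.mem_Ici.1 ht')⟩ ⟨trivial, ht.1.le⟩ h
      rw [Prod.mk.injEq] at h1
      exact absurd (Set.mem_Ici.1 ht') (not_le.2 (h1.2 ▸ ht.2)))
    (by
      rw [himg₀]
      exact s.disjoint_strips.mono_right hS₁sub)
  have hset : s.hypersurface = Set.range Φ := by
    have h1 : s.strip₁ = g₁ '' (Set.univ ×ˢ Set.Ioo 0 1) ∪ g₁ '' (Set.univ ×ˢ Set.Ici 1) := by
      rw [← himg₁, ← Set.image_union, ← Set.prod_union, Set.Ioo_union_Ici_eq_Ioi one_pos]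
    rw [hΦr, hBr, himg₀, hS₁img, hypersurface, h1, ← Set.union_assoc]
    congr 1
    exact Set.union_right_comm _ _ _
  have hemb : Topology.IsClosedEmbedding Φ := by
    refine isClosedEmbedding_of_norm_unbounded hΦ hΦi fun r => ?_
    obtain ⟨T₀, hT₀⟩ := s.isStrip₀.exists_norm_gt r
    obtain ⟨T₁, hT₁⟩ := s.isStrip₁.exists_norm_gt r
    refine ⟨max 1 (max T₀ T₁), fun u t ht => ?_⟩
    have h1 := (le_max_left _ _).trans ht
    have h2 := ((le_max_left T₀ T₁).trans (le_max_right 1 _)).trans ht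
    have h3 := ((le_max_right T₀ T₁).trans (le_max_right 1 _)).trans ht
    rcases lt_or_ge t 0 with h0 | h0
    · rw [abs_of_neg h0] at h2
      rw [hΦ0 u t h0]
      simp only [hg₀, hκe (-t) (neg_pos.2 h0).le]
      exact hT₀ _ (hmem₀ u) _ h2
    · rw [abs_of_nonneg h0] at h1 h3
      rw [hΦ1 u t h1]
      simp only [hS₁, hg₁, sub_add_cancel, hκe t h0]
      exact hT₁ _ (hmem₁ u) _ h3
  rw [hset]
  refine isOrientable_of_polar_cover hemb.isEmbedding.toHomeomorph.isLocalHomeomorph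
    hemb.isEmbedding.toHomeomorph.surjective 1 ?_ one_pos fun z z' h => ⟨0, ?_⟩
  · have : ((1 : EuclideanSpace ℝ (Fin m) ≃ₗᵢ[ℝ] EuclideanSpace ℝ (Fin m)).toLinearEquiv :
        EuclideanSpace ℝ (Fin m) →ₗ[ℝ] EuclideanSpace ℝ (Fin m)) = LinearMap.id := rfl
    rw [this, LinearMap.det_id]
    exact one_pos
  · rw [hemb.isEmbedding.toHomeomorph.injective h]
    simp

end Blocks

theorem mainTheorem3 (m N : ℕ) [NeZero m] (hn : m + 1 < N + 1) (K : HyperCaps m (N + 1))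
    (C : CapChain K) (hC : C.Embedded) :
    (∀ s : ClosingStrip C, s.Untwisted → IsOrientable m s.hypersurface) ∧
      (∀ s : InfiniteStrips C, IsOrientable m s.hypersurface) :=
  ⟨fun s hs => s.isOrientable_hypersurface hC hs, fun s => s.isOrientable_hypersurface hC⟩
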